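/- **Conventions.** $\mathbb N=\{1,2,\dots\}$. For finite sets, $E<F$ means $\max E<\min F$, and $n\le E$ means $n\le\min E$. The Schreier classes are $\mathcal S_0=\{\emptyset\}\cup\{\{n\}:n\in\mathbb N\}$, $\mathcal S_1=\{\emptyset\}\cup\{F:|F|\le\min F\}$; $\mathcal S_{\alpha+1}=\mathcal S_1[\mathcal S_\alpha]$ is the family of all unions $G_1\cup\dots\cup G_k$ ($k\ge 0$) with $\emptyset\ne G_i\in\mathcal S_\alpha$, $G_1<\dots<G_k$ and $\{\min G_1,\dots,\min G_k\}\in\mathcal S_1$; and for a countable limit ordinal $\alpha$, $\mathcal S_\alpha=\{F:\ F\in\mathcal S_{\alpha_n}\text{ and } n\le F\text{ for some }n\in\mathbb N\}$ (every $n\le\emptyset$), where $\alpha_n\uparrow\alpha$ $(\alpha_n<\alpha)$ is an arbitrary fixed choice of sequences. A block basis $(y_i)\prec(x_i)$ is an infinite sequence of nonzero finite linear combinations of the $x_j$ with successive supports; finite block sequences are defined in the same way. A finite block sequence $y_1<\dots<y_k$ of $(x_i)$ is $\mathcal S_\alpha$-admissible if $\{\min\operatorname{supp}y_1,\dots,\min\operatorname{supp}y_k\}\in\mathcal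 S_\alpha$, supports being taken with respect to $(x_i)$. For a basic sequence $(x_i)$ with closed linear span $[x_i]$ and a norm $|\cdot|$, let $\delta_\alpha((x_i),|\cdot|)$ be the supremum of all $\delta\ge0$ such that $|\sum_{i=1}^k y_i|\ge\delta\sum_{i=1}^k|y_i|$ for every $\mathcal S_\alpha$-admissible $(y_i)_1^k\prec(x_i)$; write $\delta_\alpha(x_i)$ for the original norm. Let $\dot\delta_\alpha((x_i),|\cdot|)=\sup\{\delta_\alpha((y_i),|\cdot|):(y_i)\prec(x_i)\}$, and let $\ddot\delta_\alpha(x_i)$ be the supremum of $\dot\delta_\alpha((x_i),|\cdot|)$ over all equivalent norms $|\cdot|$ on $[x_i]$. A basic sequence $(x_i)$ $\Delta$-stabilizes $\gamma=(\gamma_\alpha)_{\alpha<\omega_1}\subseteq\mathbb R$ (for a norm $|\cdot|$) if there are $\varepsilon_n\downarrow0$ such that for every $\alpha<\omega_1$ there is $m$ such that for all $n\ge m$ and all $(y_i)\prec(x_i)_{i\ge n}$, $|\delta_\alpha((y_i),|\cdot|)-\gamma_\alpha|<\varepsilon_n$. For a space $X$ with basis $(e_i)$, $\Delta(X)$ is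 the set of all $\gamma$ that are $\Delta$-stabilized by some $(x_i)\prec(e_i)$ in the norm of $X$; $\ddot\Delta(X)$ is the set of all $\gamma$ that are $\Delta$-stabilized by some $(x_i)\prec(e_i)$ under some equivalent norm on $[x_i]$. For $X$ with basis $(x_i)$ put $I_\Delta(X)=\inf\{\alpha<\omega_1:\ddot\delta_\alpha(x_i)<1\}$. The asymptotic $\ell_1$ constant of $(x_i)$ for a norm $|\cdot|$ is the infimum of all $C>0$ such that $|\sum_{i=1}^n y_i|\ge\frac1C\sum_{i=1}^n|y_i|$ for all $n$ and all finite block sequences $x_n\le y_1<\dots<y_n$ of $(x_i)$, where $x_n\le y_1$ means $n\le\operatorname{supp}y_1$ (and the infimum is $+\infty$ if there is no such $C$). Tsirelson's space $T$ is the completion of $c_{00}$ (the finitely supported real sequences) under the norm given by $$\|x\|=\max\Big(\|x\|_\infty,\ \sup\Big\{\tfrac12\sum_{i=1}^n\|E_ix\|:\ n\in\mathbb N,\ n\le E_1<\dots<E_n\Big\}\Big),$$ where the $E_i$ are finite nonempty subsets of $\mathbb N$ and $E_ix$ is the restriction of $x$ to $E_i$; $(e_i)$ is its unit vector basis. **Theorem.**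 a) If $(x_i)\prec(e_i)$, then $\delta_n(x_i)=\ddot\delta_n(x_i)=2^{-n}$ for all integers $n\ge0$. b) Every $\gamma\in\Delta(T)$ satisfies $\gamma_n=2^{-n}$ for all integers $n\ge0$ and $\gamma_\alpha=0$ for all $\omega\le\alpha<\omega_1$. c) Every $\gamma\in\ddot\Delta(T)$ satisfies $\gamma_n\le2^{-n}$ for all integers $n\ge0$. d) $I_\Delta(X)=1$ for every block subspace $X=[x_i]$, $(x_i)\prec(e_i)$. e) For every $(x_i)\prec(e_i)$, the asymptotic $\ell_1$ constant of $(x_i)$ in the norm of $T$ is $2$, and for every equivalent norm on $[x_i]$ the asymptotic $\ell_1$ constant of $(x_i)$ is at least $2$. -/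

import Mathlib

/-! Indexing: bases are indexed by Lean's natural numbers `0, 1, 2, …`; the index `i` plays the
role of the positive integer `i + 1`.  So "`F` has at most `min F` elements", for a set `F` of
positive integers, becomes `F.card ≤ i + 1` for all `i ∈ F`, and "`n ≤ E`", for `n = 1, 2, …`,
becomes `n ≤ i + 1` for all `i ∈ E`. -/

/-- A family of nonempty finite sets with `E i < E j` (that is, `max (E i) < min (E j)`)
whenever `i < j`. -/
def Successive {ι : Type*} [LT ι] (E : ι → Finset ℕ) : Prop :=
  (∀ i, (E i).Nonempty) ∧ ∀ i j, i < j → ∀ a ∈ E i, ∀ b ∈ E j, a < b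

/-- The set of the minima of finitely many (nonempty) finite sets. -/
noncomputable def minima {k : ℕ} (E : Fin k → Finset ℕ) : Finset ℕ :=
  Finset.univ.image fun i => sInf (E i : Set ℕ)

/-- `E 0 < ⋯ < E (k-1)` is `𝓕`-admissible: the set of the minima belongs to `𝓕`. -/
def IsAdmissible (𝓕 : Set (Finset ℕ)) {k : ℕ} (E : Fin k → Finset ℕ) : Prop :=
  Successive E ∧ minima E ∈ 𝓕

/-- The family `𝓕[𝓖]` of all unions of `𝓕`-admissible sequences of members of `𝓖`. -/
def famComp (𝓕 𝓖 : Set (Finset ℕ)) : Set (Finset ℕ) :=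
  {H | ∃ (k : ℕ) (G : Fin k → Finset ℕ),
    IsAdmissible 𝓕 G ∧ (∀ i, G i ∈ 𝓖) ∧ H = Finset.univ.biUnion G}

/-- `S_0`: the empty set and the singletons. -/
def schreierZero : Set (Finset ℕ) := {F | F.card ≤ 1}

/-- `S_1`: the finite sets with at most `min F` elements (and the empty set). -/
def schreierOne : Set (Finset ℕ) := {F | ∀ i ∈ F, F.card ≤ i + 1}

/-- `c` chooses, for every countable limit ordinal `l`, a sequence of ordinals below `l`
that increases to `l`. -/
def IsLadder (c : Ordinal.{0} → ℕ → Ordinal.{0}) : Prop :=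
  ∀ l : Ordinal.{0}, l < Ordinal.omega 1 → Order.IsSuccLimit l →
    Monotone (c l) ∧ (∀ n, c l n < l) ∧ ∀ b < l, ∃ n, b < c l n

/-- The Schreier classes `S_α`, for a choice `c` of sequences at the limit ordinals:
`S_{α+1} = S_1[S_α]`, and for a limit ordinal `l` a set belongs to `S_l` if for some `n`
it belongs to `S_{c l n}` and is supported from the `n`-th index on. -/
noncomputable def schreier (c : Ordinal.{0} → ℕ → Ordinal.{0}) (α : Ordinal.{0}) :
    Set (Finset ℕ) :=
  Ordinal.limitRecOn (motive := fun _ => Set (Finset ℕ)) α schreierZero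
    (fun _ S => famComp schreierOne S)
    (fun l _ S => {F | ∃ (n : ℕ) (h : c l n < l), F ∈ S (c l n) h ∧ ∀ i ∈ F, n ≤ i})

section BlockBases

variable {V : Type*} [AddCommGroup V] [Module ℝ V]

/-- `x` is a block basis of `e`: the vectors `x i` are nonzero finite linear combinations of the
`e j` with successive supports. -/
def IsBlockBasis (x e : ℕ → V) : Prop :=
  ∃ a : ℕ → ℕ →₀ ℝ, Successive (fun i => (a i).support) ∧
    ∀ i, x i = Finsupp.linearCombination ℝ e (a i)

/-- The asymptotic constant `δ_𝓕(x_i)` with respect to the norm `p`: the supremum of all `δ ≥ 0`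
with `p (∑ y_i) ≥ δ ∑ p (y_i)` for all finite block sequences `y_0 < ⋯ < y_{k-1}` of `(x_i)` that
are `𝓕`-admissible with respect to `(x_i)`.  Here `y_i = ∑_j a_i(j) x_j`. -/
noncomputable def delta (p : Seminorm ℝ V) (𝓕 : Set (Finset ℕ)) (x : ℕ → V) : ℝ :=
  sSup {d : ℝ | 0 ≤ d ∧ ∀ (k : ℕ) (a : Fin k → ℕ →₀ ℝ),
    IsAdmissible 𝓕 (fun i => (a i).support) →
      d * ∑ i, p (Finsupp.linearCombination ℝ x (a i)) ≤
        p (∑ i, Finsupp.linearCombination ℝ x (a i))}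

/-- `δ̇_𝓕(x_i)`: the supremum of `δ_𝓕(y_i)` over all block bases `(y_i)` of `(x_i)`. -/
noncomputable def dotDelta (p : Seminorm ℝ V) (𝓕 : Set (Finset ℕ)) (x : ℕ → V) : ℝ :=
  sSup {d : ℝ | ∃ y : ℕ → V, IsBlockBasis y x ∧ d = delta p 𝓕 y}

/-- `(x_i)` `Δ`-stabilizes `γ = (γ_α)_{α < ω₁}` with respect to the norm `p`. -/
def DeltaStabilizes (c : Ordinal.{0} → ℕ → Ordinal.{0}) (p : Seminorm ℝ V) (x : ℕ → V)
    (γ : Set.Iio (Ordinal.omega.{0} 1) → ℝ) : Prop :=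
  ∃ ε : ℕ → ℝ, Antitone ε ∧ Filter.Tendsto ε Filter.atTop (nhds 0) ∧
    ∀ α : Set.Iio (Ordinal.omega.{0} 1), ∃ m : ℕ, ∀ n ≥ m, ∀ y : ℕ → V,
      IsBlockBasis y (fun i => x (n + i)) → |delta p (schreier c α) y - γ α| < ε n

/-- The real numbers `C > 0` that witness that the norm `p` is asymptotic `ℓ₁` with respect to
`(x_i)`: `p (∑ y_i) ≥ (1/C) ∑ p (y_i)` for all `n` and all blocks `x_n ≤ y_1 < ⋯ < y_n`.
The infimum of this set is the asymptotic `ℓ₁` constant. -/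
def asymptoticL1Constants (p : Seminorm ℝ V) (x : ℕ → V) : Set ℝ :=
  {C : ℝ | 0 < C ∧ ∀ (n : ℕ) (a : Fin n → ℕ →₀ ℝ),
    Successive (fun i => (a i).support) → (∀ i, ∀ j ∈ (a i).support, n ≤ j + 1) →
      (1 / C) * ∑ i, p (Finsupp.linearCombination ℝ x (a i)) ≤
        p (∑ i, Finsupp.linearCombination ℝ x (a i))}

end BlockBases

section Renormings

variable {X : Type*} [NormedAddCommGroup X] [NormedSpace ℝ X]

/-- `p` is an equivalent norm on `X`. -/
def IsEquivalentNorm (p : Seminorm ℝ X) : Prop :=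
  ∃ A B : ℝ, 0 < A ∧ ∀ v, A * ‖v‖ ≤ p v ∧ p v ≤ B * ‖v‖

/-- `[x_i]`, the closed linear span of the sequence `(x_i)`. -/
def closedSpan (x : ℕ → X) : Submodule ℝ X :=
  (Submodule.span ℝ (Set.range x)).topologicalClosure

/-- The sequence `(x_i)` as a sequence in its closed linear span. -/
def inSpan (x : ℕ → X) (i : ℕ) : closedSpan x :=
  ⟨x i, Submodule.le_topologicalClosure _ (Submodule.subset_span ⟨i, rfl⟩)⟩

/-- `δ̈_𝓕(x_i)`: the supremum of `δ̇_𝓕((x_i), |·|)` over all equivalent norms `|·|` on `[x_i]`. -/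
noncomputable def ddotDelta (𝓕 : Set (Finset ℕ)) (x : ℕ → X) : ℝ :=
  sSup {d : ℝ | ∃ p : Seminorm ℝ (closedSpan x),
    IsEquivalentNorm p ∧ d = dotDelta p 𝓕 (inSpan x)}

/-- The spectrum `Δ` of the space spanned by the basis `(e_i)`. -/
def deltaSpectrum (c : Ordinal.{0} → ℕ → Ordinal.{0}) (e : ℕ → X) :
    Set (Set.Iio (Ordinal.omega.{0} 1) → ℝ) :=
  {γ | ∃ x : ℕ → X, IsBlockBasis x e ∧ DeltaStabilizes c (normSeminorm ℝ X) x γ}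

/-- The spectrum `Δ̈` of the space spanned by the basis `(e_i)`. -/
def ddotDeltaSpectrum (c : Ordinal.{0} → ℕ → Ordinal.{0}) (e : ℕ → X) :
    Set (Set.Iio (Ordinal.omega.{0} 1) → ℝ) :=
  {γ | ∃ x : ℕ → X, IsBlockBasis x e ∧ ∃ p : Seminorm ℝ (closedSpan x),
    IsEquivalentNorm p ∧ DeltaStabilizes c p (inSpan x) γ}

/-- The spectral index `I_Δ` of the space `[x_i]` with the basis `(x_i)`: the least countable
ordinal `α` with `δ̈_α(x_i) < 1`. -/
noncomputable def spectralIndex (c : Ordinal.{0} → ℕ → Ordinal.{0}) (x : ℕ → X) : Ordinal.{0} :=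
  sInf {α : Ordinal.{0} | α < Ordinal.omega 1 ∧ ddotDelta (schreier c α) x < 1}

end Renormings

/-- The natural number `n` as a countable ordinal. -/
noncomputable def finiteIndex (n : ℕ) : Set.Iio (Ordinal.omega.{0} 1) :=
  ⟨(n : Ordinal.{0}), (Ordinal.natCast_lt_omega0 n).trans Ordinal.omega0_lt_omega_one⟩

/-! Tsirelson's space.  The norm is obtained by iteration and is shown to satisfy the implicit
equation `‖x‖ = max (‖x‖_∞, sup {½ ∑ ‖E_i x‖ : n ≤ E_1 < ⋯ < E_n})`. -/

/-- `‖x‖_∞`. -/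
noncomputable def supNorm (x : ℕ →₀ ℝ) : ℝ := ⨆ i, |x i|

/-- The restriction `E x` of `x` to the set `E`. -/
noncomputable def restr (E : Finset ℕ) (x : ℕ →₀ ℝ) : ℕ →₀ ℝ := x.filter (· ∈ E)

/-- All the numbers `½ ∑ N (E_i x)`, where `n ≤ E_1 < ⋯ < E_n`. -/
def tsirelsonSums (N : (ℕ →₀ ℝ) → ℝ) (x : ℕ →₀ ℝ) : Set ℝ :=
  {r | ∃ (n : ℕ) (E : Fin n → Finset ℕ), Successive E ∧ (∀ i, ∀ j ∈ E i, n ≤ j + 1) ∧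
    r = 1 / 2 * ∑ i, N (restr (E i) x)}

/-- The iterated norms `‖·‖_m` that increase to Tsirelson's norm. -/
noncomputable def tsirelsonIter : ℕ → (ℕ →₀ ℝ) → ℝ
  | 0, x => supNorm x
  | m + 1, x => max (supNorm x) (sSup (tsirelsonSums (tsirelsonIter m) x))

/-- Tsirelson's norm on the finitely supported sequences. -/
noncomputable def tsirelsonNorm (x : ℕ →₀ ℝ) : ℝ := ⨆ m, tsirelsonIter m x

section TsirelsonFacts

lemma abs_le_supNorm (x : ℕ →₀ ℝ) (i : ℕ) : |x i| ≤ supNorm x := by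
  have h : BddAbove (Set.range fun i => |x i|) := by
    refine ⟨∑ j ∈ x.support, |x j|, ?_⟩
    rintro _ ⟨i, rfl⟩
    by_cases hi : i ∈ x.support
    · exact Finset.single_le_sum (f := fun j => |x j|) (fun j _ => abs_nonneg _) hi
    · simp only [Finsupp.notMem_support_iff.mp hi, abs_zero]
      exact Finset.sum_nonneg fun j _ => abs_nonneg _
  exact le_ciSup h i

lemma supNorm_le {x : ℕ →₀ ℝ} {r : ℝ} (h : ∀ i, |x i| ≤ r) : supNorm x ≤ r := ciSup_le h

/-- The `ℓ₁` norm. -/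
noncomputable def l1Norm (x : ℕ →₀ ℝ) : ℝ := ∑ j ∈ x.support, |x j|

lemma supNorm_nonneg (x : ℕ →₀ ℝ) : 0 ≤ supNorm x := (abs_nonneg _).trans (abs_le_supNorm x 0)

lemma supNorm_le_l1 (x : ℕ →₀ ℝ) : supNorm x ≤ l1Norm x := by
  refine supNorm_le fun i => ?_
  by_cases hi : i ∈ x.support
  · exact Finset.single_le_sum (f := fun j => |x j|) (fun j _ => abs_nonneg _) hi
  · simp only [Finsupp.notMem_support_iff.mp hi, abs_zero]
    exact Finset.sum_nonneg fun j _ => abs_nonneg _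

lemma l1Norm_restr (E : Finset ℕ) (x : ℕ →₀ ℝ) :
    l1Norm (restr E x) = ∑ j ∈ x.support, if j ∈ E then |x j| else 0 := by
  rw [l1Norm, restr, Finsupp.support_filter, Finset.sum_filter]
  refine Finset.sum_congr rfl fun j _ => ?_
  split_ifs with h
  · rw [Finsupp.filter_apply_pos (· ∈ E) x h]
  · rfl

lemma sum_l1Norm_restr_le {n : ℕ} {E : Fin n → Finset ℕ} (hE : Successive E) (x : ℕ →₀ ℝ) :
    ∑ i, l1Norm (restr (E i) x) ≤ l1Norm x := by
  simp only [l1Norm_restr]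
  rw [Finset.sum_comm, l1Norm]
  refine Finset.sum_le_sum fun j _ => ?_
  by_cases h : ∃ i, j ∈ E i
  · obtain ⟨i, hi⟩ := h
    rw [Finset.sum_eq_single i]
    · rw [if_pos hi]
    · intro b _ hb
      rw [if_neg]
      intro hj
      rcases lt_or_gt_of_ne hb with h' | h'
      · exact lt_irrefl _ (hE.2 b i h' j hj j hi)
      · exact lt_irrefl _ (hE.2 i b h' j hi j hj)
    · intro h'
      exact absurd (Finset.mem_univ i) h'
  · push Not at h
    rw [Finset.sum_eq_zero fun i _ => if_neg (h i)]
    exact abs_nonneg _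

lemma restr_add (E : Finset ℕ) (x y : ℕ →₀ ℝ) : restr E (x + y) = restr E x + restr E y :=
  Finsupp.filter_add

lemma restr_smul (E : Finset ℕ) (r : ℝ) (x : ℕ →₀ ℝ) : restr E (r • x) = r • restr E x :=
  Finsupp.filter_smul

lemma tsirelsonSums_zero_mem (N : (ℕ →₀ ℝ) → ℝ) (x : ℕ →₀ ℝ) : (0 : ℝ) ∈ tsirelsonSums N x :=
  ⟨0, fun i => i.elim0, ⟨fun i => i.elim0, fun i => i.elim0⟩, fun i => i.elim0, by simp⟩

lemma le_l1_of_mem_tsirelsonSums {N : (ℕ →₀ ℝ) → ℝ} (hN : ∀ x, 0 ≤ N x ∧ N x ≤ l1Norm x)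
    {x : ℕ →₀ ℝ} {r : ℝ} (hr : r ∈ tsirelsonSums N x) : r ≤ l1Norm x := by
  obtain ⟨n, E, hE, -, rfl⟩ := hr
  have h1 : ∑ i, N (restr (E i) x) ≤ l1Norm x :=
    (Finset.sum_le_sum fun i _ => (hN _).2).trans (sum_l1Norm_restr_le hE x)
  have h2 : 0 ≤ ∑ i, N (restr (E i) x) := Finset.sum_nonneg fun i _ => (hN _).1
  linarith

lemma tsirelsonIter_bounds (m : ℕ) (x : ℕ →₀ ℝ) :
    0 ≤ tsirelsonIter m x ∧ tsirelsonIter m x ≤ l1Norm x := by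
  induction m generalizing x with
  | zero => exact ⟨supNorm_nonneg x, supNorm_le_l1 x⟩
  | succ m ih =>
    refine ⟨le_max_of_le_left (supNorm_nonneg x), max_le (supNorm_le_l1 x) ?_⟩
    exact csSup_le ⟨0, tsirelsonSums_zero_mem _ x⟩ fun r hr => le_l1_of_mem_tsirelsonSums ih hr

lemma bddAbove_tsirelsonSums {N : (ℕ →₀ ℝ) → ℝ} (hN : ∀ x, 0 ≤ N x ∧ N x ≤ l1Norm x)
    (x : ℕ →₀ ℝ) : BddAbove (tsirelsonSums N x) :=
  ⟨l1Norm x, fun _ hr => le_l1_of_mem_tsirelsonSums hN hr⟩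

lemma bddAbove_tsirelsonIter (x : ℕ →₀ ℝ) : BddAbove (Set.range fun m => tsirelsonIter m x) := by
  refine ⟨l1Norm x, ?_⟩
  rintro _ ⟨m, rfl⟩
  exact (tsirelsonIter_bounds m x).2

lemma tsirelsonIter_add_le (m : ℕ) (x y : ℕ →₀ ℝ) :
    tsirelsonIter m (x + y) ≤ tsirelsonIter m x + tsirelsonIter m y := by
  have hs : supNorm (x + y) ≤ supNorm x + supNorm y := supNorm_le fun i =>
    (abs_add_le _ _).trans (add_le_add (abs_le_supNorm x i) (abs_le_supNorm y i))
  induction m generalizing x y with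
  | zero => exact hs
  | succ m ih =>
    refine max_le (hs.trans (add_le_add (le_max_left _ _) (le_max_left _ _))) ?_
    refine csSup_le ⟨0, tsirelsonSums_zero_mem _ _⟩ ?_
    rintro _ ⟨n, E, hE, hn, rfl⟩
    have hx : 1 / 2 * ∑ i, tsirelsonIter m (restr (E i) x) ≤ tsirelsonIter (m + 1) x :=
      le_max_of_le_right (le_csSup (bddAbove_tsirelsonSums (tsirelsonIter_bounds m) x)
        ⟨n, E, hE, hn, rfl⟩)
    have hy : 1 / 2 * ∑ i, tsirelsonIter m (restr (E i) y) ≤ tsirelsonIter (m + 1) y :=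
      le_max_of_le_right (le_csSup (bddAbove_tsirelsonSums (tsirelsonIter_bounds m) y)
        ⟨n, E, hE, hn, rfl⟩)
    have h : ∑ i, tsirelsonIter m (restr (E i) (x + y)) ≤
        ∑ i, tsirelsonIter m (restr (E i) x) + ∑ i, tsirelsonIter m (restr (E i) y) := by
      rw [← Finset.sum_add_distrib]
      refine Finset.sum_le_sum fun i _ => ?_
      rw [restr_add]
      refine ih _ _ (supNorm_le fun j => ?_)
      exact (abs_add_le _ _).trans (add_le_add (abs_le_supNorm _ j) (abs_le_supNorm _ j))
    linarith

lemma tsirelsonIter_smul_le (m : ℕ) (r : ℝ) (x : ℕ →₀ ℝ) :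
    tsirelsonIter m (r • x) ≤ |r| * tsirelsonIter m x := by
  have hs : ∀ x : ℕ →₀ ℝ, supNorm (r • x) ≤ |r| * supNorm x := fun x => supNorm_le fun i => by
    rw [Finsupp.smul_apply, smul_eq_mul, abs_mul]
    exact mul_le_mul_of_nonneg_left (abs_le_supNorm x i) (abs_nonneg r)
  induction m generalizing x with
  | zero => exact hs x
  | succ m ih =>
    refine max_le ((hs x).trans (mul_le_mul_of_nonneg_left (le_max_left _ _) (abs_nonneg r))) ?_
    refine csSup_le ⟨0, tsirelsonSums_zero_mem _ _⟩ ?_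
    rintro _ ⟨n, E, hE, hn, rfl⟩
    have hx : 1 / 2 * ∑ i, tsirelsonIter m (restr (E i) x) ≤ tsirelsonIter (m + 1) x :=
      le_max_of_le_right (le_csSup (bddAbove_tsirelsonSums (tsirelsonIter_bounds m) x)
        ⟨n, E, hE, hn, rfl⟩)
    have h : ∑ i, tsirelsonIter m (restr (E i) (r • x)) ≤
        |r| * ∑ i, tsirelsonIter m (restr (E i) x) := by
      rw [Finset.mul_sum]
      refine Finset.sum_le_sum fun i _ => ?_
      rw [restr_smul]
      exact ih _
    have h' := mul_le_mul_of_nonneg_left hx (abs_nonneg r)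
    linarith

lemma tsirelsonIter_le_norm (m : ℕ) (x : ℕ →₀ ℝ) : tsirelsonIter m x ≤ tsirelsonNorm x :=
  le_ciSup (bddAbove_tsirelsonIter x) m

lemma tsirelsonNorm_bounds (x : ℕ →₀ ℝ) : 0 ≤ tsirelsonNorm x ∧ tsirelsonNorm x ≤ l1Norm x :=
  ⟨(tsirelsonIter_bounds 0 x).1.trans (tsirelsonIter_le_norm 0 x),
    ciSup_le fun m => (tsirelsonIter_bounds m x).2⟩

lemma supNorm_le_tsirelsonNorm (x : ℕ →₀ ℝ) : supNorm x ≤ tsirelsonNorm x :=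
  tsirelsonIter_le_norm 0 x

lemma tsirelsonNorm_add_le (x y : ℕ →₀ ℝ) :
    tsirelsonNorm (x + y) ≤ tsirelsonNorm x + tsirelsonNorm y :=
  ciSup_le fun m => (tsirelsonIter_add_le m x y).trans
    (add_le_add (tsirelsonIter_le_norm m x) (tsirelsonIter_le_norm m y))

lemma tsirelsonNorm_smul_le (r : ℝ) (x : ℕ →₀ ℝ) :
    tsirelsonNorm (r • x) ≤ |r| * tsirelsonNorm x :=
  ciSup_le fun m => (tsirelsonIter_smul_le m r x).trans
    (mul_le_mul_of_nonneg_left (tsirelsonIter_le_norm m x) (abs_nonneg r))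

lemma tsirelsonNorm_smul (r : ℝ) (x : ℕ →₀ ℝ) :
    tsirelsonNorm (r • x) = |r| * tsirelsonNorm x := by
  refine le_antisymm (tsirelsonNorm_smul_le r x) ?_
  rcases eq_or_ne r 0 with rfl | hr
  · simpa using (tsirelsonNorm_bounds _).1
  · have h := tsirelsonNorm_smul_le r⁻¹ (r • x)
    rw [smul_smul, inv_mul_cancel₀ hr, one_smul, abs_inv] at h
    have hr' : 0 < |r| := abs_pos.mpr hr
    calc |r| * tsirelsonNorm x ≤ |r| * (|r|⁻¹ * tsirelsonNorm (r • x)) :=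
          mul_le_mul_of_nonneg_left h hr'.le
      _ = tsirelsonNorm (r • x) := by field_simp

lemma tsirelsonNorm_eq_zero (x : ℕ →₀ ℝ) : tsirelsonNorm x = 0 ↔ x = 0 := by
  constructor
  · intro h
    ext i
    have := (abs_le_supNorm x i).trans (supNorm_le_tsirelsonNorm x)
    rw [h] at this
    simpa using this
  · rintro rfl
    have h := tsirelsonNorm_bounds 0
    have h' : l1Norm 0 = 0 := by simp [l1Norm]
    rw [h'] at h
    exact le_antisymm h.2 h.1

lemma tsirelsonIter_le_succ (m : ℕ) (x : ℕ →₀ ℝ) :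
    tsirelsonIter m x ≤ tsirelsonIter (m + 1) x := by
  induction m generalizing x with
  | zero => exact le_max_left _ _
  | succ m ih =>
    refine max_le_max le_rfl (csSup_le ⟨0, tsirelsonSums_zero_mem _ _⟩ ?_)
    rintro _ ⟨n, E, hE, hn, rfl⟩
    refine le_trans ?_ (le_csSup (bddAbove_tsirelsonSums (tsirelsonIter_bounds (m + 1)) x)
      ⟨n, E, hE, hn, rfl⟩)
    exact mul_le_mul_of_nonneg_left (Finset.sum_le_sum fun i _ => ih _) (by norm_num)

/-- Tsirelson's norm satisfies the implicit equation. -/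
theorem tsirelsonNorm_eq (x : ℕ →₀ ℝ) :
    BddAbove (tsirelsonSums tsirelsonNorm x) ∧
      tsirelsonNorm x = max (supNorm x) (sSup (tsirelsonSums tsirelsonNorm x)) := by
  have hb := bddAbove_tsirelsonSums tsirelsonNorm_bounds x
  refine ⟨hb, le_antisymm (ciSup_le fun m => ?_) (max_le (supNorm_le_tsirelsonNorm x) ?_)⟩
  · cases m with
    | zero => exact le_max_left _ _
    | succ m =>
      refine max_le_max le_rfl (csSup_le ⟨0, tsirelsonSums_zero_mem _ _⟩ ?_)
      rintro _ ⟨n, E, hE, hn, rfl⟩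
      refine le_trans ?_ (le_csSup hb ⟨n, E, hE, hn, rfl⟩)
      exact mul_le_mul_of_nonneg_left
        (Finset.sum_le_sum fun i _ => tsirelsonIter_le_norm m _) (by norm_num)
  · refine csSup_le ⟨0, tsirelsonSums_zero_mem _ _⟩ ?_
    rintro _ ⟨n, E, hE, hn, rfl⟩
    have h1 : ∀ i, Filter.Tendsto (fun m => tsirelsonIter m (restr (E i) x)) Filter.atTop
        (nhds (tsirelsonNorm (restr (E i) x))) := fun i =>
      tendsto_atTop_ciSup (monotone_nat_of_le_succ fun m => tsirelsonIter_le_succ m _)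
        (bddAbove_tsirelsonIter _)
    have h2 : Filter.Tendsto (fun m => ∑ i, tsirelsonIter m (restr (E i) x)) Filter.atTop
        (nhds (∑ i, tsirelsonNorm (restr (E i) x))) :=
      tendsto_finsetSum _ fun i _ => h1 i
    have ht := h2.const_mul (1 / 2 : ℝ)
    refine le_of_tendsto' ht fun m => ?_
    refine le_trans ?_ (tsirelsonIter_le_norm (m + 1) x)
    exact le_max_of_le_right (le_csSup (bddAbove_tsirelsonSums (tsirelsonIter_bounds m) x)
      ⟨n, E, hE, hn, rfl⟩)

end TsirelsonFacts

/-- The space `c₀₀` of finitely supported sequences, to be given Tsirelson's norm. -/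
def TsirelsonC00 : Type := ℕ →₀ ℝ

noncomputable instance : AddCommGroup TsirelsonC00 := inferInstanceAs (AddCommGroup (ℕ →₀ ℝ))

noncomputable instance : Module ℝ TsirelsonC00 := inferInstanceAs (Module ℝ (ℕ →₀ ℝ))

noncomputable instance : Norm TsirelsonC00 := ⟨tsirelsonNorm⟩

lemma tsirelsonC00_core : NormedSpace.Core ℝ TsirelsonC00 where
  norm_nonneg x := (tsirelsonNorm_bounds x).1
  norm_smul r x := tsirelsonNorm_smul r x
  norm_triangle x y := tsirelsonNorm_add_le x y
  norm_eq_zero_iff x := tsirelsonNorm_eq_zero x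

noncomputable instance : NormedAddCommGroup TsirelsonC00 :=
  NormedAddCommGroup.ofCore tsirelsonC00_core

noncomputable instance : NormedSpace ℝ TsirelsonC00 := NormedSpace.ofCore tsirelsonC00_core

/-- Tsirelson's space `T`: the completion of `c₀₀` with Tsirelson's norm. -/
abbrev TsirelsonSpace : Type := UniformSpace.Completion TsirelsonC00

/-- The finitely supported sequence `x` as an element of `TsirelsonC00`. -/
def toTsirelsonC00 (x : ℕ →₀ ℝ) : TsirelsonC00 := x

/-- The unit vector basis of `T`. -/
noncomputable def tsirelsonBasis (i : ℕ) : TsirelsonSpace :=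
  ((toTsirelsonC00 (Finsupp.single i 1) : TsirelsonC00) : TsirelsonSpace)

/-! ### Successive families of finite sets, indexed by their minima. -/

section FiniteSets

/-! Lower bound. The implicit equation gives the constant 1/2 on `S_1`-admissible families, and
iterating it along `S_{n+1} = S_1[S_n]` gives `2^{-n}` on `S_n` (`pow_mul_sum_tsirelsonNorm_le`).
Block bases inherit this, because the `i`-th block is supported from `i` on.

Upper bound, also under renorming. For every `m` there are averages of normalized blocks over a set
in `S_{m+1}` with Tsirelson norm at most `2 · 2^{-m}`. Unfolding the norm `m` times gives a factor
`2^{-m}` except on a set of indices of restricted shape (`IsSmall`,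
`exists_isSmall_tsirelsonNorm_sum_le`), and repeated averages give such sets almost no mass
(`exists_average`). Under an equivalent norm, a lower estimate on `S_{m+1}` therefore has constant
at most `C · 2^{-m}`, with `C` depending on the renorming (`IsTsirelsonLike.exists_le`).

The constant `C` is then removed by supermultiplicativity. Since `S_{n+m}` is contained in
`S_n[S_m]`, an estimate `d` on `S_n` gives `d^k` on `S_{nk}`, so `d > 2^{-n}` would contradict the
upper bound for large `k` (`HasLowerEstimate.le_pow`). For `α ≥ ω`, the class `S_α` contains the
tail of every finite class, which forces the constant 0 (`HasLowerEstimate.eq_zero`). The statements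
on the spectra, the index and the asymptotic `ℓ₁` constant follow from these bounds. -/

/-- A family of finite sets indexed by a set `M` of natural numbers, in such a way that the
index of each set is its minimum and the sets are successive. -/
structure MinIndexed (M : Finset ℕ) (G : ℕ → Finset ℕ) : Prop where
  mem : ∀ μ ∈ M, μ ∈ G μ
  le : ∀ μ ∈ M, ∀ j ∈ G μ, μ ≤ j
  lt : ∀ μ ∈ M, ∀ ν ∈ M, μ < ν → ∀ j ∈ G μ, j < ν

lemma sInf_mem_of_nonempty {E : Finset ℕ} (h : E.Nonempty) : sInf (E : Set ℕ) ∈ E :=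
  Finset.mem_coe.1 (Nat.sInf_mem (Finset.coe_nonempty.2 h))

lemma sInf_le_of_mem {E : Finset ℕ} {j : ℕ} (h : j ∈ E) : sInf (E : Set ℕ) ≤ j :=
  Nat.sInf_le (Finset.mem_coe.2 h)

lemma Successive.strictMono_sInf {k : ℕ} {E : Fin k → Finset ℕ} (hE : Successive E) :
    StrictMono fun i => sInf (E i : Set ℕ) := fun i j hij =>
  hE.2 i j hij _ (sInf_mem_of_nonempty (hE.1 i)) _ (sInf_mem_of_nonempty (hE.1 j))

lemma Successive.le_of_mem {Z : ℕ → Finset ℕ} (hZ : Successive Z) (i : ℕ) :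
    ∀ t ∈ Z i, i ≤ t := by
  induction i with
  | zero => simp
  | succ i ih =>
    intro t ht
    obtain ⟨s, hs⟩ := hZ.1 i
    have h1 := ih s hs
    have h2 := hZ.2 i (i + 1) (Nat.lt_succ_self i) s hs t ht
    omega

/-- The family indexed by minima associated with a finite successive family. -/
noncomputable def byMin {k : ℕ} {β : Type*} [Inhabited β] (E : Fin k → Finset ℕ) (f : Fin k → β) :
    ℕ → β :=
  Function.extend (fun i => sInf (E i : Set ℕ)) f fun _ => default

lemma byMin_apply {k : ℕ} {β : Type*} [Inhabited β] {E : Fin k → Finset ℕ} (hE : Successive E)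
    (f : Fin k → β) (i : Fin k) : byMin E f (sInf (E i : Set ℕ)) = f i :=
  hE.strictMono_sInf.injective.extend_apply f _ i

lemma mem_minima {k : ℕ} {E : Fin k → Finset ℕ} {μ : ℕ} :
    μ ∈ minima E ↔ ∃ i, sInf (E i : Set ℕ) = μ := by
  simp [minima]

lemma Successive.minIndexed {k : ℕ} {E : Fin k → Finset ℕ} (hE : Successive E)
    {G : ℕ → Finset ℕ} (hG : ∀ i, G (sInf (E i : Set ℕ)) = E i) :
    MinIndexed (minima E) G where
  mem μ hμ := by
    obtain ⟨i, rfl⟩ := mem_minima.1 hμ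
    rw [hG]
    exact sInf_mem_of_nonempty (hE.1 i)
  le μ hμ j hj := by
    obtain ⟨i, rfl⟩ := mem_minima.1 hμ
    rw [hG] at hj
    exact sInf_le_of_mem hj
  lt μ hμ ν hν h j hj := by
    obtain ⟨i, rfl⟩ := mem_minima.1 hμ
    obtain ⟨i', rfl⟩ := mem_minima.1 hν
    rw [hG] at hj
    exact hE.2 i i' (hE.strictMono_sInf.lt_iff_lt.1 h) j hj _ (sInf_mem_of_nonempty (hE.1 i'))

lemma sum_minima {k : ℕ} {E : Fin k → Finset ℕ} (hE : Successive E) {β : Type*}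
    [AddCommMonoid β] (f : ℕ → β) :
    ∑ μ ∈ minima E, f μ = ∑ i, f (sInf (E i : Set ℕ)) :=
  Finset.sum_image fun _ _ _ _ h => hE.strictMono_sInf.injective h

lemma MinIndexed.sInf_eq {M : Finset ℕ} {G : ℕ → Finset ℕ} (h : MinIndexed M G) {μ : ℕ}
    (hμ : μ ∈ M) : sInf (G μ : Set ℕ) = μ :=
  le_antisymm (sInf_le_of_mem (h.mem μ hμ))
    (h.le μ hμ _ (sInf_mem_of_nonempty ⟨μ, h.mem μ hμ⟩))

lemma MinIndexed.successive {M : Finset ℕ} {G : ℕ → Finset ℕ} (h : MinIndexed M G) :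
    Successive fun i : Fin M.card => G (M.orderEmbOfFin rfl i) := by
  have hm : ∀ i, M.orderEmbOfFin rfl i ∈ M := M.orderEmbOfFin_mem rfl
  refine ⟨fun i => ⟨_, h.mem _ (hm i)⟩, fun i j hij a ha b hb => ?_⟩
  exact (h.lt _ (hm i) _ (hm j) ((M.orderEmbOfFin rfl).strictMono hij) a ha).trans_le
    (h.le _ (hm j) b hb)

lemma MinIndexed.minima_eq {M : Finset ℕ} {G : ℕ → Finset ℕ} (h : MinIndexed M G) :
    minima (fun i : Fin M.card => G (M.orderEmbOfFin rfl i)) = M := by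
  conv_rhs => rw [← Finset.image_orderEmbOfFin_univ M rfl]
  exact Finset.image_congr fun i _ => h.sInf_eq (M.orderEmbOfFin_mem rfl i)

lemma sum_orderEmbOfFin {β : Type*} [AddCommMonoid β] (M : Finset ℕ) (f : ℕ → β) :
    ∑ i : Fin M.card, f (M.orderEmbOfFin rfl i) = ∑ μ ∈ M, f μ := by
  conv_rhs => rw [← Finset.image_orderEmbOfFin_univ M rfl]
  rw [Finset.sum_image fun _ _ _ _ h => (M.orderEmbOfFin rfl).injective h]

lemma MinIndexed.mono {M N : Finset ℕ} {G : ℕ → Finset ℕ} (h : MinIndexed M G) (hN : N ⊆ M) :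
    MinIndexed N G :=
  ⟨fun μ hμ => h.mem μ (hN hμ), fun μ hμ => h.le μ (hN hμ),
    fun μ hμ ν hν => h.lt μ (hN hμ) ν (hN hν)⟩

/-- `H` is the union of a family of members of `𝓖` that is indexed by minima in `M`. -/
def IsDecomp (𝓖 : Set (Finset ℕ)) (M H : Finset ℕ) : Prop :=
  ∃ G : ℕ → Finset ℕ, MinIndexed M G ∧ (∀ μ ∈ M, G μ ∈ 𝓖) ∧ H = M.biUnion G

/-- Labelling each piece by its minimum turns the set of minima into the index set itself, so that
nested decompositions can be composed without renumbering. -/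
lemma mem_famComp_iff {𝓕 𝓖 : Set (Finset ℕ)} {H : Finset ℕ} :
    H ∈ famComp 𝓕 𝓖 ↔ ∃ M ∈ 𝓕, IsDecomp 𝓖 M H := by
  constructor
  · rintro ⟨k, G, ⟨hG, hM⟩, hG', rfl⟩
    refine ⟨minima G, hM, byMin G G, hG.minIndexed (byMin_apply hG G), ?_, ?_⟩
    · intro μ hμ
      obtain ⟨i, rfl⟩ := mem_minima.1 hμ
      rw [byMin_apply hG G]
      exact hG' i
    · ext j
      simp only [Finset.mem_biUnion, Finset.mem_univ, true_and, mem_minima]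
      constructor
      · rintro ⟨i, hi⟩
        exact ⟨_, ⟨i, rfl⟩, by rwa [byMin_apply hG G]⟩
      · rintro ⟨_, ⟨i, rfl⟩, hi⟩
        exact ⟨i, by rwa [byMin_apply hG G] at hi⟩
  · rintro ⟨M, hM, G, hG, hG', rfl⟩
    refine ⟨M.card, _, ⟨hG.successive, by rwa [hG.minima_eq]⟩,
      fun i => hG' _ (M.orderEmbOfFin_mem rfl i), ?_⟩
    conv_lhs => rw [← Finset.image_orderEmbOfFin_univ M rfl]
    rw [Finset.image_biUnion]

lemma IsDecomp.empty (𝓖 : Set (Finset ℕ)) : IsDecomp 𝓖 ∅ ∅ :=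
  ⟨fun _ => ∅, ⟨by simp, by simp, by simp⟩, by simp, by simp⟩

lemma IsDecomp.subset {𝓖 : Set (Finset ℕ)} {M H : Finset ℕ} (h : IsDecomp 𝓖 M H) : M ⊆ H := by
  obtain ⟨G, hG, -, rfl⟩ := h
  exact fun μ hμ => Finset.mem_biUnion.2 ⟨μ, hμ, hG.mem μ hμ⟩

/-- Builds decompositions by appending one later set at a time; the new label is the minimum of `F`.
-/
lemma IsDecomp.insert {𝓖 : Set (Finset ℕ)} {M H F : Finset ℕ} (h : IsDecomp 𝓖 M H)
    (hF : F ∈ 𝓖) (hne : F.Nonempty) (hlt : ∀ i ∈ H, ∀ j ∈ F, i < j) :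
    ∃ μ ∈ F, μ ∉ M ∧ IsDecomp 𝓖 (insert μ M) (H ∪ F) := by
  have hMH := h.subset
  obtain ⟨G, hG, hG', rfl⟩ := h
  have hmin := F.min'_mem hne
  set m := F.min' hne with hm
  have hmM : ∀ μ ∈ M, μ < m := fun μ hμ => hlt μ (hMH hμ) m hmin
  have hup : ∀ μ ∈ M, Function.update G m F μ = G μ := fun μ hμ =>
    Function.update_of_ne (hmM μ hμ).ne _ _
  refine ⟨m, hmin, fun hM => lt_irrefl _ (hmM m hM), Function.update G m F, ⟨?_, ?_, ?_⟩, ?_, ?_⟩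
  · intro μ hμ
    rcases Finset.mem_insert.1 hμ with rfl | hμ
    · rwa [Function.update_self]
    · rw [hup μ hμ]; exact hG.mem μ hμ
  · intro μ hμ
    rcases Finset.mem_insert.1 hμ with rfl | hμ
    · rw [Function.update_self]; exact fun j hj => F.min'_le j hj
    · rw [hup μ hμ]; exact hG.le μ hμ
  · intro μ hμ ν hν hlt' j hj
    rcases Finset.mem_insert.1 hμ with rfl | hμ
    · rcases Finset.mem_insert.1 hν with rfl | hν
      · exact absurd hlt' (lt_irrefl _)
      · exact absurd (hlt'.trans (hmM ν hν)) (lt_irrefl _)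
    · rw [hup μ hμ] at hj
      rcases Finset.mem_insert.1 hν with rfl | hν
      · exact hlt j (Finset.mem_biUnion.2 ⟨μ, hμ, hj⟩) _ hmin
      · exact hG.lt μ hμ ν hν hlt' j hj
  · intro μ hμ
    rcases Finset.mem_insert.1 hμ with rfl | hμ
    · rwa [Function.update_self]
    · rw [hup μ hμ]; exact hG' μ hμ
  · rw [Finset.biUnion_insert, Function.update_self, Finset.union_comm]
    congr 1
    exact Finset.biUnion_congr rfl fun μ hμ => (hup μ hμ).symm

end FiniteSets

/-! ### The Schreier classes. -/

section Schreier

variable {c : Ordinal.{0} → ℕ → Ordinal.{0}}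

lemma schreier_zero : schreier c ((0 : ℕ) : Ordinal.{0}) = schreierZero := by
  rw [Nat.cast_zero]
  exact Ordinal.limitRecOn_zero ..

lemma schreier_add_one (α : Ordinal.{0}) :
    schreier c (α + 1) = famComp schreierOne (schreier c α) :=
  Ordinal.limitRecOn_add_one ..

lemma schreier_succ (n : ℕ) : schreier c ((n + 1 : ℕ) : Ordinal.{0}) =
    famComp schreierOne (schreier c (n : Ordinal.{0})) := by
  rw [Nat.cast_succ]
  exact schreier_add_one _

lemma schreier_limit {l : Ordinal.{0}} (hl : Order.IsSuccLimit l) :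
    schreier c l = {F | ∃ (n : ℕ) (_ : c l n < l), F ∈ schreier c (c l n) ∧ ∀ i ∈ F, n ≤ i} :=
  Ordinal.limitRecOn_limit (motive := fun _ => Set (Finset ℕ)) _ _ _ _ hl

lemma mem_famComp_schreierOne_self {𝓖 : Set (Finset ℕ)} {F : Finset ℕ} (hF : F ∈ 𝓖) :
    F ∈ famComp schreierOne 𝓖 := by
  rw [mem_famComp_iff]
  rcases F.eq_empty_or_nonempty with rfl | hne
  · exact ⟨∅, by simp [schreierOne], IsDecomp.empty _⟩
  · obtain ⟨μ, -, -, h⟩ := (IsDecomp.empty 𝓖).insert hF hne (by simp)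
    rw [Finset.empty_union] at h
    exact ⟨_, by simp [schreierOne], h⟩

lemma singleton_mem_schreier (n : ℕ) (i : ℕ) :
    {i} ∈ schreier c (n : Ordinal.{0}) := by
  induction n with
  | zero => rw [schreier_zero]; simp [schreierZero]
  | succ n ih => rw [schreier_succ]; exact mem_famComp_schreierOne_self ih

/-- Nonempty members of `S_0` are singletons, so a union of them coincides with its set of minima.
-/
lemma schreier_one : schreier c ((1 : ℕ) : Ordinal.{0}) = schreierOne := by
  ext F
  rw [schreier_succ, mem_famComp_iff]
  constructor
  · rintro ⟨M, hM, G, hG, hG', rfl⟩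
    have h : ∀ μ ∈ M, G μ = {μ} := fun μ hμ => by
      have h1 := hG' μ hμ
      rw [schreier_zero] at h1
      exact Finset.eq_singleton_iff_unique_mem.2
        ⟨hG.mem μ hμ, fun j hj => Finset.card_le_one.1 h1 j hj μ (hG.mem μ hμ)⟩
    rw [Finset.biUnion_congr rfl h, Finset.biUnion_singleton_eq_self]
    exact hM
  · intro hF
    refine ⟨F, hF, fun μ => {μ}, ⟨by simp, by simp, by simp⟩, fun μ _ => ?_, by simp⟩
    exact singleton_mem_schreier 0 μ

/-- A smaller Schreier class is eventually contained in a larger one. -/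
lemma exists_mem_schreier_of_le (hc : IsLadder c) {β : Ordinal.{0}} (α : Ordinal.{0})
    (hα : α < Ordinal.omega 1) (hβ : β ≤ α) :
    ∃ N : ℕ, ∀ F ∈ schreier c β, (∀ i ∈ F, N ≤ i) → F ∈ schreier c α := by
  induction α using Ordinal.limitRecOn with
  | zero =>
    obtain rfl : β = 0 := le_antisymm hβ zero_le
    exact ⟨0, fun F hF _ => hF⟩
  | add_one α ih =>
    rcases hβ.eq_or_lt with rfl | hlt
    · exact ⟨0, fun F hF _ => hF⟩
    · obtain ⟨N, hN⟩ := ih ((lt_add_one α).trans hα) (Order.lt_add_one_iff.1 hlt)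
      refine ⟨N, fun F hF h => ?_⟩
      rw [schreier_add_one]
      exact mem_famComp_schreierOne_self (hN F hF h)
  | limit l hl ih =>
    rcases hβ.eq_or_lt with rfl | hlt
    · exact ⟨0, fun F hF _ => hF⟩
    · obtain ⟨-, h1, h2⟩ := hc l hα hl
      obtain ⟨n, hn⟩ := h2 β hlt
      obtain ⟨N, hN⟩ := ih _ (h1 n) ((h1 n).trans hα) hn.le
      -- `N` serves the inductive inclusion into the `n`-th ladder class, and `n` the tail condition
      -- in the limit class.
      refine ⟨max N n, fun F hF h => ?_⟩
      rw [schreier_limit hl]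
      exact ⟨n, h1 n, hN F hF fun i hi => (le_max_left _ _).trans (h i hi),
        fun i hi => (le_max_right _ _).trans (h i hi)⟩

/-- Every member of `S_{n+m}` decomposes as an `S_n`-admissible union of members of `S_m`. -/
lemma exists_isDecomp_schreier_add (n m : ℕ) {F : Finset ℕ}
    (hF : F ∈ schreier c ((n + m : ℕ) : Ordinal.{0})) :
    ∃ M ∈ schreier c (n : Ordinal.{0}), IsDecomp (schreier c (m : Ordinal.{0})) M F := by
  induction n generalizing F with
  | zero =>
    rw [Nat.zero_add] at hF
    rw [schreier_zero]
    rcases F.eq_empty_or_nonempty with rfl | hne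
    · exact ⟨∅, by simp [schreierZero], IsDecomp.empty _⟩
    · obtain ⟨μ, -, -, h⟩ := (IsDecomp.empty _).insert hF hne (by simp)
      rw [Finset.empty_union] at h
      exact ⟨_, by simp [schreierZero], h⟩
  | succ n ih =>
    rw [Nat.add_right_comm, schreier_succ, mem_famComp_iff] at hF
    obtain ⟨N, hN, H, hH, hH', rfl⟩ := hF
    choose! M hM G hG hG' hHG using fun ν (hν : ν ∈ N) => ih (hH' ν hν)
    have hMH : ∀ ν ∈ N, M ν ⊆ H ν := fun ν hν => by
      rw [hHG ν hν]
      exact fun μ hμ => Finset.mem_biUnion.2 ⟨μ, hμ, (hG ν hν).mem μ hμ⟩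
    have hGH : ∀ ν ∈ N, ∀ μ ∈ M ν, G ν μ ⊆ H ν := fun ν hν μ hμ => by
      conv_rhs => rw [hHG ν hν]
      exact Finset.subset_biUnion_of_mem _ hμ
    -- The inner piece of `H ν` that contains `ν` cannot start before `ν`, so its label is `ν`;
    -- hence `ν ∈ M ν`.
    have hMI : MinIndexed N M := by
      refine ⟨fun ν hν => ?_, fun ν hν j hj => hH.le ν hν j (hMH ν hν hj),
        fun ν hν ν' hν' h j hj => hH.lt ν hν ν' hν' h j (hMH ν hν hj)⟩
      have h1 := hH.mem ν hν
      rw [hHG ν hν] at h1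
      obtain ⟨μ, hμ, h2⟩ := Finset.mem_biUnion.1 h1
      have h3 := (hG ν hν).le μ hμ ν h2
      have h4 := hH.le ν hν μ (hMH ν hν hμ)
      rwa [le_antisymm h3 h4] at hμ
    -- `σ μ` is the outer piece to which the inner label `μ` belongs; it is unique because the outer
    -- pieces are successive.
    have hsel : ∀ μ ∈ N.biUnion M, ∃ ν ∈ N, μ ∈ M ν := fun μ hμ => Finset.mem_biUnion.1 hμ
    choose! σ hσN hσM using hsel
    have hσ : ∀ ν ∈ N, ∀ μ ∈ M ν, σ μ = ν := by
      intro ν hν μ hμ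
      have hμ' : μ ∈ N.biUnion M := Finset.mem_biUnion.2 ⟨ν, hν, hμ⟩
      have h1 := hσN μ hμ'
      have h2 := hσM μ hμ'
      rcases lt_trichotomy (σ μ) ν with h | h | h
      · exact absurd (hMI.lt _ h1 _ hν h _ h2) (not_lt.2 (hMI.le _ hν _ hμ))
      · exact h
      · exact absurd (hMI.lt _ hν _ h1 h _ hμ) (not_lt.2 (hMI.le _ h1 _ h2))
    refine ⟨N.biUnion M, ?_, fun μ => G (σ μ) μ, ⟨?_, ?_, ?_⟩, ?_, ?_⟩
    · rw [schreier_succ, mem_famComp_iff]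
      exact ⟨N, hN, M, hMI, hM, rfl⟩
    · exact fun μ hμ => (hG _ (hσN μ hμ)).mem μ (hσM μ hμ)
    · exact fun μ hμ => (hG _ (hσN μ hμ)).le μ (hσM μ hμ)
    · intro μ hμ μ' hμ' hlt j hj
      rcases lt_trichotomy (σ μ) (σ μ') with h | h | h
      · exact (hH.lt _ (hσN μ hμ) _ (hσN μ' hμ') h j
          (hGH _ (hσN μ hμ) μ (hσM μ hμ) hj)).trans_le (hMI.le _ (hσN μ' hμ') _ (hσM μ' hμ'))
      · exact (hG _ (hσN μ hμ)).lt μ (hσM μ hμ) μ' (h ▸ hσM μ' hμ') hlt j hj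
      · exact absurd ((hMI.lt _ (hσN μ' hμ') _ (hσN μ hμ) h _ (hσM μ' hμ')).trans_le
          (hMI.le _ (hσN μ hμ) _ (hσM μ hμ))) hlt.asymm
    · exact fun μ hμ => hG' _ (hσN μ hμ) μ (hσM μ hμ)
    · rw [Finset.biUnion_biUnion]
      refine Finset.biUnion_congr rfl fun ν hν => ?_
      conv_lhs => rw [hHG ν hν]
      exact Finset.biUnion_congr rfl fun μ hμ => by rw [hσ ν hν μ hμ]

end Schreier

/-! ### Lower `ℓ₁` estimates and their supermultiplicativity. -/

section LowerEstimates

/-- `q (∑ u_μ) ≥ d ∑ q (u_μ)` for all finite `𝓕`-admissible families of vectors. -/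
def HasLowerEstimate (q : Seminorm ℝ (ℕ →₀ ℝ)) (𝓕 : Set (Finset ℕ)) (d : ℝ) : Prop :=
  ∀ M ∈ 𝓕, ∀ u : ℕ → ℕ →₀ ℝ, MinIndexed M (fun μ => (u μ).support) →
    d * ∑ μ ∈ M, q (u μ) ≤ q (∑ μ ∈ M, u μ)

lemma hasLowerEstimate_iff {q : Seminorm ℝ (ℕ →₀ ℝ)} {𝓕 : Set (Finset ℕ)} {d : ℝ} :
    HasLowerEstimate q 𝓕 d ↔ ∀ (k : ℕ) (a : Fin k → ℕ →₀ ℝ),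
      IsAdmissible 𝓕 (fun i => (a i).support) → d * ∑ i, q (a i) ≤ q (∑ i, a i) := by
  constructor
  · rintro h k a ⟨ha, hM⟩
    have hb := byMin_apply ha a
    have := h _ hM (byMin _ a) (ha.minIndexed fun i => by rw [hb])
    simpa only [sum_minima ha, hb] using this
  · intro h M hM u hu
    have := h M.card (fun i => u (M.orderEmbOfFin rfl i))
      ⟨hu.successive, by rwa [hu.minima_eq]⟩
    rwa [sum_orderEmbOfFin M fun μ => q (u μ), sum_orderEmbOfFin M u] at this

/-- Split an `S_{n+m}`-admissible family into `S_m`-admissible groups whose sums form an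
`S_n`-admissible family; apply one estimate to the group sums and the other inside each group. -/
lemma HasLowerEstimate.add {q : Seminorm ℝ (ℕ →₀ ℝ)} {c : Ordinal.{0} → ℕ → Ordinal.{0}}
    {n m : ℕ} {d e : ℝ} (hd : 0 ≤ d) (hn : HasLowerEstimate q (schreier c n) d)
    (hm : HasLowerEstimate q (schreier c m) e) :
    HasLowerEstimate q (schreier c ((n + m : ℕ) : Ordinal.{0})) (d * e) := by
  intro F hF u hu
  obtain ⟨M, hM, G, hG, hG', rfl⟩ := exists_isDecomp_schreier_add n m hF
  have hdisj : (M : Set ℕ).PairwiseDisjoint G := by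
    intro μ hμ ν hν hne
    refine Finset.disjoint_left.2 fun j hj hj' => ?_
    rcases lt_or_gt_of_ne hne with h | h
    · exact absurd (hG.lt μ hμ ν hν h j hj) (not_lt.2 (hG.le ν hν j hj'))
    · exact absurd (hG.lt ν hν μ hμ h j hj') (not_lt.2 (hG.le μ hμ j hj))
  rw [Finset.sum_biUnion hdisj, Finset.sum_biUnion hdisj]
  have hsub : ∀ μ ∈ M, G μ ⊆ M.biUnion G := fun μ hμ => Finset.subset_biUnion_of_mem _ hμ
  have hw : ∀ μ, ∀ j ∈ (∑ κ ∈ G μ, u κ).support, ∃ κ ∈ G μ, j ∈ (u κ).support := by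
    intro μ j hj
    exact Finset.mem_biUnion.1 (Finsupp.support_finsetSum hj)
  -- No cancellation occurs at coordinate `μ`: the other vectors of the group are supported strictly
  -- beyond it.
  have hmem : ∀ μ ∈ M, μ ∈ (∑ κ ∈ G μ, u κ).support := by
    intro μ hμ
    rw [Finsupp.mem_support_iff, Finsupp.finsetSum_apply, Finset.sum_eq_single μ]
    · exact Finsupp.mem_support_iff.1 (hu.mem μ (hsub μ hμ (hG.mem μ hμ)))
    · intro κ hκ hne
      by_contra h0
      have h1 := hu.le κ (hsub μ hμ hκ) μ (Finsupp.mem_support_iff.2 h0)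
      exact hne (le_antisymm h1 (hG.le μ hμ κ hκ))
    · exact fun h => absurd (hG.mem μ hμ) h
  have h1 := hn M hM (fun μ => ∑ κ ∈ G μ, u κ) ⟨hmem, ?_, ?_⟩
  · refine le_trans ?_ h1
    rw [mul_assoc]
    refine mul_le_mul_of_nonneg_left ?_ hd
    rw [Finset.mul_sum]
    exact Finset.sum_le_sum fun μ hμ => hm _ (hG' μ hμ) u (hu.mono (hsub μ hμ))
  · intro μ hμ j hj
    obtain ⟨κ, hκ, hj⟩ := hw μ j hj
    exact (hG.le μ hμ κ hκ).trans (hu.le κ (hsub μ hμ hκ) j hj)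
  · intro μ hμ ν hν hlt j hj
    obtain ⟨κ, hκ, hj⟩ := hw μ j hj
    exact hu.lt κ (hsub μ hμ hκ) ν (hsub ν hν (hG.mem ν hν)) (hG.lt μ hμ ν hν hlt κ hκ) j hj

lemma HasLowerEstimate.pow {q : Seminorm ℝ (ℕ →₀ ℝ)} {c : Ordinal.{0} → ℕ → Ordinal.{0}}
    {n : ℕ} {d : ℝ} (hd : 0 ≤ d) (hn : HasLowerEstimate q (schreier c n) d) (k : ℕ) :
    HasLowerEstimate q (schreier c ((n * (k + 1) : ℕ) : Ordinal.{0})) (d ^ (k + 1)) := by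
  induction k with
  | zero => simpa using hn
  | succ k ih =>
    rw [Nat.mul_succ, pow_succ]
    exact ih.add (pow_nonneg hd _) hn

end LowerEstimates

/-! ### Lower and upper estimates for block sequences in Tsirelson's norm. -/

section TsirelsonEstimates

lemma restr_apply (E : Finset ℕ) (x : ℕ →₀ ℝ) (j : ℕ) :
    restr E x j = if j ∈ E then x j else 0 :=
  Finsupp.filter_apply (· ∈ E) x j

lemma restr_comm (E F : Finset ℕ) (x : ℕ →₀ ℝ) : restr E (restr F x) = restr F (restr E x) := by
  ext j
  simp only [restr_apply]
  split_ifs <;> rfl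

lemma restr_sum {ι : Type*} (E : Finset ℕ) (s : Finset ι) (f : ι → ℕ →₀ ℝ) :
    restr E (∑ i ∈ s, f i) = ∑ i ∈ s, restr E (f i) := by
  ext j
  simp only [restr_apply, Finsupp.finsetSum_apply]
  split_ifs <;> simp

lemma mem_support_restr {E : Finset ℕ} {x : ℕ →₀ ℝ} {j : ℕ} :
    j ∈ (restr E x).support ↔ j ∈ E ∧ j ∈ x.support := by
  simp [restr_apply]

lemma supNorm_restr_le (E : Finset ℕ) (x : ℕ →₀ ℝ) : supNorm (restr E x) ≤ supNorm x :=
  supNorm_le fun i => by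
    rw [restr_apply]
    split_ifs
    · exact abs_le_supNorm x i
    · rw [abs_zero]; exact supNorm_nonneg x

lemma tsirelsonIter_restr_le (m : ℕ) (F : Finset ℕ) (x : ℕ →₀ ℝ) :
    tsirelsonIter m (restr F x) ≤ tsirelsonIter m x := by
  induction m generalizing x with
  | zero => exact supNorm_restr_le F x
  | succ m ih =>
    refine max_le_max (supNorm_restr_le F x) (csSup_le ⟨0, tsirelsonSums_zero_mem _ _⟩ ?_)
    rintro _ ⟨n, E, hE, hn, rfl⟩
    refine le_trans ?_ (le_csSup (bddAbove_tsirelsonSums (tsirelsonIter_bounds m) x)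
      ⟨n, E, hE, hn, rfl⟩)
    refine mul_le_mul_of_nonneg_left (Finset.sum_le_sum fun i _ => ?_) (by norm_num)
    rw [restr_comm]
    exact ih _

lemma tsirelsonNorm_restr_le (F : Finset ℕ) (x : ℕ →₀ ℝ) :
    tsirelsonNorm (restr F x) ≤ tsirelsonNorm x :=
  ciSup_le fun m => (tsirelsonIter_restr_le m F x).trans (tsirelsonIter_le_norm m x)

lemma half_sum_restr_le {n : ℕ} {E : Fin n → Finset ℕ} (hE : Successive E)
    (hn : ∀ i, ∀ j ∈ E i, n ≤ j + 1) (x : ℕ →₀ ℝ) :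
    1 / 2 * ∑ i, tsirelsonNorm (restr (E i) x) ≤ tsirelsonNorm x := by
  obtain ⟨hb, h⟩ := tsirelsonNorm_eq x
  rw [h]
  exact le_max_of_le_right (le_csSup hb ⟨n, E, hE, hn, rfl⟩)

lemma tsirelsonNorm_zero : tsirelsonNorm 0 = 0 := (tsirelsonNorm_eq_zero 0).2 rfl

lemma tsirelsonNorm_nonneg (x : ℕ →₀ ℝ) : 0 ≤ tsirelsonNorm x := (tsirelsonNorm_bounds x).1

lemma tsirelsonNorm_sum_le {ι : Type*} (s : Finset ι) (f : ι → ℕ →₀ ℝ) :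
    tsirelsonNorm (∑ i ∈ s, f i) ≤ ∑ i ∈ s, tsirelsonNorm (f i) :=
  Finset.le_sum_of_subadditive _ tsirelsonNorm_zero.le tsirelsonNorm_add_le _ _

/-- The defining lower estimate of Tsirelson's norm for successive vectors. -/
lemma half_sum_tsirelsonNorm_le {N : Finset ℕ} {w : ℕ → ℕ →₀ ℝ}
    (hw : ∀ μ ∈ N, ∀ ν ∈ N, μ < ν → ∀ j ∈ (w μ).support, ∀ j' ∈ (w ν).support, j < j')
    (hN : ∀ μ ∈ N, ∀ j ∈ (w μ).support, N.card ≤ j + 1) :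
    1 / 2 * ∑ μ ∈ N, tsirelsonNorm (w μ) ≤ tsirelsonNorm (∑ μ ∈ N, w μ) := by
  classical
  -- Zero vectors are dropped because `Successive` requires nonempty supports; they do not change
  -- the sums.
  set N' := N.filter fun μ => w μ ≠ 0 with hN'
  have hsub : N' ⊆ N := Finset.filter_subset _ _
  have hm : ∀ i, N'.orderEmbOfFin rfl i ∈ N' := N'.orderEmbOfFin_mem rfl
  have hE : Successive fun i : Fin N'.card => (w (N'.orderEmbOfFin rfl i)).support :=
    ⟨fun i => Finsupp.support_nonempty_iff.2 (Finset.mem_filter.1 (hm i)).2,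
      fun i j hij => hw _ (hsub (hm i)) _ (hsub (hm j)) ((N'.orderEmbOfFin rfl).strictMono hij)⟩
  have hr : ∀ μ ∈ N, restr (w μ).support (∑ ν ∈ N, w ν) = w μ := by
    intro μ hμ
    ext j
    rw [restr_apply]
    split_ifs with hj
    · rw [Finsupp.finsetSum_apply, Finset.sum_eq_single μ]
      · intro ν hν hne
        by_contra h0
        have hj' := Finsupp.mem_support_iff.2 h0
        rcases lt_or_gt_of_ne hne with h | h
        · exact lt_irrefl _ (hw ν hν μ hμ h j hj' j hj)
        · exact lt_irrefl _ (hw μ hμ ν hν h j hj j hj')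
      · exact fun h => absurd hμ h
    · exact (Finsupp.notMem_support_iff.1 hj).symm
  have h := half_sum_restr_le hE (fun i j hj =>
    (Finset.card_le_card hsub).trans (hN _ (hsub (hm i)) j hj)) (∑ ν ∈ N, w ν)
  simp only [hr _ (hsub (hm _))] at h
  rw [sum_orderEmbOfFin N' fun μ => tsirelsonNorm (w μ)] at h
  convert h using 2
  refine (Finset.sum_subset hsub fun μ hμ hμ' => ?_).symm
  have : w μ = 0 := by
    by_contra h0
    exact hμ' (Finset.mem_filter.2 ⟨hμ, h0⟩)
  rw [this, tsirelsonNorm_zero]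

/-- Tsirelson's norm satisfies a lower `ℓ₁` estimate with constant `2^{-n}` on `S_n`-admissible
families. -/
lemma pow_mul_sum_tsirelsonNorm_le {c : Ordinal.{0} → ℕ → Ordinal.{0}} (n : ℕ) {M : Finset ℕ}
    (hM : M ∈ schreier c (n : Ordinal.{0})) {v : ℕ → ℕ →₀ ℝ}
    (hv : ∀ μ ∈ M, ∀ ν ∈ M, μ < ν → ∀ j ∈ (v μ).support, ∀ j' ∈ (v ν).support, j < j')
    (hle : ∀ μ ∈ M, ∀ j ∈ (v μ).support, μ ≤ j) :
    (1 / 2 : ℝ) ^ n * ∑ μ ∈ M, tsirelsonNorm (v μ) ≤ tsirelsonNorm (∑ μ ∈ M, v μ) := by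
  induction n generalizing M with
  | zero =>
    rw [schreier_zero] at hM
    rcases Finset.card_le_one_iff_subset_singleton.1 hM with ⟨μ, hμ⟩
    rcases Finset.subset_singleton_iff.1 hμ with rfl | rfl <;> simp [tsirelsonNorm_zero]
  | succ n ih =>
    rw [schreier_succ, mem_famComp_iff] at hM
    obtain ⟨N, hN, G, hG, hG', rfl⟩ := hM
    have hdisj : (N : Set ℕ).PairwiseDisjoint G := by
      intro μ hμ ν hν hne
      refine Finset.disjoint_left.2 fun j hj hj' => ?_
      rcases lt_or_gt_of_ne hne with h | h
      · exact absurd (hG.lt μ hμ ν hν h j hj) (not_lt.2 (hG.le ν hν j hj'))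
      · exact absurd (hG.lt ν hν μ hμ h j hj') (not_lt.2 (hG.le μ hμ j hj))
    have hsub : ∀ μ ∈ N, G μ ⊆ N.biUnion G := fun μ hμ => Finset.subset_biUnion_of_mem _ hμ
    have hw : ∀ μ, ∀ j ∈ (∑ κ ∈ G μ, v κ).support, ∃ κ ∈ G μ, j ∈ (v κ).support := by
      intro μ j hj
      exact Finset.mem_biUnion.1 (Finsupp.support_finsetSum hj)
    rw [Finset.sum_biUnion hdisj, Finset.sum_biUnion hdisj]
    -- The outer `S_1` layer costs one factor 1/2 and the inner `S_n` pieces cost `2^{-n}` by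
    -- induction. Supports need only begin at or after their labels, so a label may be a position in
    -- a block basis.
    refine le_trans ?_ (half_sum_tsirelsonNorm_le ?_ ?_)
    · rw [pow_succ', mul_assoc]
      refine mul_le_mul_of_nonneg_left ?_ (by norm_num)
      rw [Finset.mul_sum]
      refine Finset.sum_le_sum fun μ hμ => ih (hG' μ hμ) ?_ ?_
      · exact fun κ hκ κ' hκ' => hv κ (hsub μ hμ hκ) κ' (hsub μ hμ hκ')
      · exact fun κ hκ => hle κ (hsub μ hμ hκ)
    · intro μ hμ ν hν hlt j hj j' hj'
      obtain ⟨κ, hκ, hj⟩ := hw μ j hj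
      obtain ⟨κ', hκ', hj'⟩ := hw ν j' hj'
      exact hv κ (hsub μ hμ hκ) κ' (hsub ν hν hκ')
        ((hG.lt μ hμ ν hν hlt κ hκ).trans_le (hG.le ν hν κ' hκ')) j hj j' hj'
    · intro μ hμ j hj
      obtain ⟨κ, hκ, hj⟩ := hw μ j hj
      have h1 := hN μ hμ
      have h2 := hG.le μ hμ κ hκ
      have h3 := hle κ (hsub μ hμ hκ) j hj
      omega

/-- The sets of indices that functionals of depth less than `m` in Tsirelson's norm can reach
along blocks with supports bounded by `τ`. -/
def IsSmall (τ : ℕ → ℕ) : ℕ → Finset ℕ → Prop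
  | 0, F => F = ∅
  | m + 1, F => ∃ (d : ℕ) (J : Finset ℕ) (G : Fin d → Finset ℕ), (∀ i ∈ F, d ≤ τ i + 1) ∧
    J.card ≤ d ∧ (∀ l, IsSmall τ m (G l)) ∧ F ⊆ J ∪ Finset.univ.biUnion G

lemma isSmall_empty (τ : ℕ → ℕ) (m : ℕ) : IsSmall τ m ∅ := by
  cases m with
  | zero => rfl
  | succ m => exact ⟨0, ∅, fun i => i.elim0, by simp, by simp, fun i => i.elim0, by simp⟩

lemma IsSmall.subset {τ : ℕ → ℕ} {m : ℕ} {F F' : Finset ℕ} (h : IsSmall τ m F) (hs : F' ⊆ F) :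
    IsSmall τ m F' := by
  cases m with
  | zero => exact Finset.subset_empty.1 ((show F = ∅ from h) ▸ hs)
  | succ m =>
    obtain ⟨d, J, G, h1, h2, h3, h4⟩ := h
    exact ⟨d, J, G, fun i hi => h1 i (hs hi), h2, h3, hs.trans h4⟩

lemma isSmall_singleton (τ : ℕ → ℕ) (m i : ℕ) : IsSmall τ (m + 1) {i} :=
  ⟨1, {i}, fun _ => ∅, by simp, by simp, fun _ => isSmall_empty τ m, by simp⟩

/-- Upper estimate for block sequences in Tsirelson's norm. -/
lemma exists_isSmall_tsirelsonNorm_sum_le (τ : ℕ → ℕ) (m : ℕ) {y : ℕ → ℕ →₀ ℝ}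
    (hy : ∀ i i', i < i' → ∀ j ∈ (y i).support, ∀ j' ∈ (y i').support, j < j')
    (hy1 : ∀ i, tsirelsonNorm (y i) ≤ 1) (hτ : ∀ i, ∀ j ∈ (y i).support, j ≤ τ i)
    {a : ℕ → ℝ} (ha : ∀ i, 0 ≤ a i) (s : Finset ℕ) :
    ∃ F ⊆ s, IsSmall τ m F ∧
      tsirelsonNorm (∑ i ∈ s, a i • y i) ≤ (1 / 2 : ℝ) ^ m * ∑ i ∈ s, a i + ∑ i ∈ F, a i := by
  classical
  have hsmul : ∀ i, tsirelsonNorm (a i • y i) ≤ a i := fun i => by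
    rw [tsirelsonNorm_smul, abs_of_nonneg (ha i)]
    exact mul_le_of_le_one_right (ha i) (hy1 i)
  induction m generalizing y s with
  | zero =>
    refine ⟨∅, by simp, rfl, ?_⟩
    simpa using (tsirelsonNorm_sum_le _ _).trans (Finset.sum_le_sum fun i _ => hsmul i)
  | succ m ih =>
    -- The norm is a supremum over families `E`, each producing its own small set; a small subset of
    -- `s` of maximal mass serves for all of them.
    obtain ⟨F₀, hF₀, hmax⟩ := (s.powerset.filter (IsSmall τ (m + 1))).exists_max_image
      (fun F => ∑ i ∈ F, a i)
      ⟨∅, Finset.mem_filter.2 ⟨Finset.empty_mem_powerset s, isSmall_empty τ _⟩⟩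
    obtain ⟨hF₀s, hF₀⟩ := Finset.mem_filter.1 hF₀
    have hmax' : ∀ F ⊆ s, IsSmall τ (m + 1) F → ∑ i ∈ F, a i ≤ ∑ i ∈ F₀, a i := fun F hF hF' =>
      hmax F (Finset.mem_filter.2 ⟨Finset.mem_powerset.2 hF, hF'⟩)
    have hpos : ∀ t : Finset ℕ, 0 ≤ ∑ i ∈ t, a i := fun t => Finset.sum_nonneg fun i _ => ha i
    refine ⟨F₀, Finset.mem_powerset.1 hF₀s, hF₀, ?_⟩
    rw [(tsirelsonNorm_eq _).2]
    refine max_le (supNorm_le fun j => ?_) (csSup_le ⟨0, tsirelsonSums_zero_mem _ _⟩ ?_)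
    · refine le_trans ?_ (le_add_of_nonneg_left (mul_nonneg (by positivity) (hpos s)))
      by_cases hj : ∃ i ∈ s, j ∈ (y i).support
      · obtain ⟨i, hi, hj⟩ := hj
        have hx : (∑ i ∈ s, a i • y i) j = a i * y i j := by
          rw [Finsupp.finsetSum_apply, Finset.sum_eq_single i]
          · rfl
          · intro i' _ hne
            rw [Finsupp.smul_apply, smul_eq_mul, mul_eq_zero]
            right
            by_contra h0
            have hj' := Finsupp.mem_support_iff.2 h0
            rcases lt_or_gt_of_ne hne with h | h
            · exact lt_irrefl _ (hy i' i h j hj' j hj)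
            · exact lt_irrefl _ (hy i i' h j hj j hj')
          · exact fun h => absurd hi h
        rw [hx, abs_mul, abs_of_nonneg (ha i)]
        have h1 := ((abs_le_supNorm (y i) j).trans (supNorm_le_tsirelsonNorm _)).trans (hy1 i)
        refine (mul_le_of_le_one_right (ha i) h1).trans ?_
        have := hmax' {i} (Finset.singleton_subset_iff.2 hi) (isSmall_singleton τ m i)
        rwa [Finset.sum_singleton] at this
      · push Not at hj
        rw [Finsupp.finsetSum_apply, Finset.sum_eq_zero, abs_zero]
        · exact hpos _
        · intro i hi
          rw [Finsupp.smul_apply, Finsupp.notMem_support_iff.1 (hj i hi), smul_zero]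
    · rintro _ ⟨n, E, hE, hn, rfl⟩
      -- `L i` records which sets `E l` meet block `i`. Blocks split by at least two of them go to
      -- `J`; those met by `E l` alone go to `I l`.
      set L : ℕ → Finset (Fin n) := fun i =>
        Finset.univ.filter fun l => ∃ j ∈ E l, j ∈ (y i).support with hL
      have memL : ∀ i l, l ∈ L i ↔ ∃ j ∈ E l, j ∈ (y i).support := fun i l => by simp [hL]
      set J := s.filter fun i => 2 ≤ (L i).card with hJ
      set I : Fin n → Finset ℕ := fun l => s.filter fun i => (L i).card ≤ 1 ∧ l ∈ L i with hI
      have memJ : ∀ i, i ∈ J ↔ i ∈ s ∧ 2 ≤ (L i).card := fun i => by simp [hJ]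
      have memI : ∀ l i, i ∈ I l ↔ i ∈ s ∧ (L i).card ≤ 1 ∧ l ∈ L i := fun l i => by simp [hI]
      have hLmono : ∀ i i', i < i' → ∀ l ∈ L i, ∀ l' ∈ L i', l ≤ l' := by
        intro i i' hii l hl l' hl'
        obtain ⟨j, hj, hj'⟩ := (memL i l).1 hl
        obtain ⟨k, hk, hk'⟩ := (memL i' l').1 hl'
        by_contra hlt
        exact (hy i i' hii j hj' k hk').asymm (hE.2 l' l (not_le.1 hlt) k hk j hj)
      have hJne : ∀ i ∈ J, (L i).Nonempty := fun i hi =>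
        Finset.card_pos.1 (by have := ((memJ i).1 hi).2; omega)
      -- Along `J` the least element of `L i` strictly increases: each `L i` has two elements, and
      -- it ends no later than the next one begins.
      have hJcard : J.card ≤ n := by
        rcases J.eq_empty_or_nonempty with h0 | ⟨i₀, hi₀⟩
        · simp [h0]
        · have hn0 : 0 < n := by
            obtain ⟨l, -⟩ := hJne i₀ hi₀
            exact l.pos
          have key : ∀ i ∈ J, ∀ i' ∈ J, i < i' → ∀ (h : (L i).Nonempty) (h' : (L i').Nonempty),
              (L i).min' h < (L i').min' h' := by
            intro i hi i' hi' hlt h h'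
            have h2 : (L i).min' h < (L i).max' h :=
              Finset.min'_lt_max'_of_card _ (by have := ((memJ i).1 hi).2; omega)
            exact h2.trans_le (hLmono i i' hlt _ (Finset.max'_mem _ _) _ (Finset.min'_mem _ _))
          have hinj : Set.InjOn (fun i => if h : (L i).Nonempty then (L i).min' h else ⟨0, hn0⟩)
              (J : Set ℕ) := by
            intro i hi i' hi' heq
            have h := hJne i hi
            have h' := hJne i' hi'
            simp only [dif_pos h, dif_pos h'] at heq
            rcases lt_trichotomy i i' with hlt | rfl | hlt
            · exact absurd heq (key i hi i' hi' hlt h h').ne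
            · rfl
            · exact absurd heq (key i' hi' i hi hlt h' h).ne'
          simpa using Finset.card_le_card_of_injOn _ (fun i _ => Finset.mem_univ _) hinj
      have hIdisj : ∀ l l', l ≠ l' → Disjoint (I l) (I l') := by
        intro l l' hne
        refine Finset.disjoint_left.2 fun i hi hi' => hne ?_
        obtain ⟨-, h1, h2⟩ := (memI l i).1 hi
        exact Finset.card_le_one.1 h1 _ h2 _ ((memI l' i).1 hi').2.2
      have hJI : ∀ l, Disjoint J (I l) := fun l => by
        refine Finset.disjoint_left.2 fun i hi hi' => ?_
        have h1 := ((memJ i).1 hi).2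
        have h2 := ((memI l i).1 hi').2.1
        omega
      -- The induction hypothesis is applied to the restricted blocks `E_l y_i`, which is why it
      -- must hold for all block sequences of norm at most 1.
      have hstep : ∀ l, ∃ F ⊆ I l, IsSmall τ m F ∧
          tsirelsonNorm (∑ i ∈ I l, a i • restr (E l) (y i)) ≤
            (1 / 2 : ℝ) ^ m * ∑ i ∈ I l, a i + ∑ i ∈ F, a i := by
        intro l
        have h1 : ∀ i, tsirelsonNorm (restr (E l) (y i)) ≤ 1 := fun i =>
          (tsirelsonNorm_restr_le _ _).trans (hy1 i)
        refine ih ?_ h1 ?_ (I l) ?_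
        · exact fun i i' h j hj j' hj' =>
            hy i i' h j (mem_support_restr.1 hj).2 j' (mem_support_restr.1 hj').2
        · exact fun i j hj => hτ i j (mem_support_restr.1 hj).2
        · intro i
          rw [tsirelsonNorm_smul, abs_of_nonneg (ha i)]
          exact mul_le_of_le_one_right (ha i) (h1 i)
      choose F hFI hFs hF using hstep
      have hsplit : ∀ l, restr (E l) (∑ i ∈ s, a i • y i) =
          ∑ i ∈ J, a i • restr (E l) (y i) + ∑ i ∈ I l, a i • restr (E l) (y i) := by
        intro l
        rw [restr_sum, ← Finset.sum_union (hJI l)]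
        simp only [restr_smul]
        refine (Finset.sum_subset ?_ fun i hi hi' => ?_).symm
        · exact Finset.union_subset (Finset.filter_subset _ _) (Finset.filter_subset _ _)
        · have hl : l ∉ L i := by
            intro hl
            refine hi' (Finset.mem_union.2 ?_)
            rcases Nat.lt_or_ge 1 (L i).card with h | h
            · exact Or.inl ((memJ i).2 ⟨hi, h⟩)
            · exact Or.inr ((memI l i).2 ⟨hi, h, hl⟩)
          have h0 : restr (E l) (y i) = 0 := by
            rw [← Finsupp.support_eq_empty, Finset.eq_empty_iff_forall_notMem]
            intro j hj
            rw [mem_support_restr] at hj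
            exact hl ((memL i l).2 ⟨j, hj.1, hj.2⟩)
          rw [h0, smul_zero]
      -- For a split block the implicit equation gives `½ ∑_l ‖E_l y_i‖ ≤ ‖y_i‖ ≤ 1`, so it
      -- contributes at most its coefficient.
      have hJbound : 1 / 2 * ∑ l, tsirelsonNorm (∑ i ∈ J, a i • restr (E l) (y i)) ≤
          ∑ i ∈ J, a i := by
        have h1 : ∑ l, tsirelsonNorm (∑ i ∈ J, a i • restr (E l) (y i)) ≤
            ∑ i ∈ J, a i * ∑ l, tsirelsonNorm (restr (E l) (y i)) := by
          simp only [Finset.mul_sum]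
          rw [Finset.sum_comm]
          refine Finset.sum_le_sum fun l _ => (tsirelsonNorm_sum_le _ _).trans ?_
          exact Finset.sum_le_sum fun i _ => by
            rw [tsirelsonNorm_smul, abs_of_nonneg (ha i)]
        refine (mul_le_mul_of_nonneg_left h1 (by norm_num)).trans ?_
        rw [Finset.mul_sum]
        refine Finset.sum_le_sum fun i _ => ?_
        have h2 := (half_sum_restr_le hE hn (y i)).trans (hy1 i)
        have h3 := mul_le_mul_of_nonneg_left h2 (ha i)
        linarith
      have hIsum : ∑ l, ∑ i ∈ I l, a i ≤ ∑ i ∈ s, a i := by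
        rw [← Finset.sum_biUnion fun l _ l' _ h => hIdisj l l' h]
        exact Finset.sum_le_sum_of_subset_of_nonneg
          (Finset.biUnion_subset.2 fun l _ => Finset.filter_subset _ _) fun i _ _ => ha i
      have hFsum : ∑ i ∈ J, a i + ∑ l, ∑ i ∈ F l, a i = ∑ i ∈ J ∪ Finset.univ.biUnion F, a i := by
        rw [Finset.sum_union, Finset.sum_biUnion]
        · exact fun l _ l' _ h => (hIdisj l l' h).mono (hFI l) (hFI l')
        · rw [Finset.disjoint_biUnion_right]
          exact fun l _ => (hJI l).mono_right (hFI l)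
      have hfin := hmax' (J ∪ Finset.univ.biUnion F)
        (Finset.union_subset (Finset.filter_subset _ _) (Finset.biUnion_subset.2 fun l _ =>
          (hFI l).trans (Finset.filter_subset _ _)))
        ⟨n, J, F, ?_, hJcard, hFs, subset_rfl⟩
      · have hsum : ∑ l, tsirelsonNorm (restr (E l) (∑ i ∈ s, a i • y i)) ≤
            ∑ l, tsirelsonNorm (∑ i ∈ J, a i • restr (E l) (y i)) +
              ((1 / 2 : ℝ) ^ m * ∑ l, ∑ i ∈ I l, a i + ∑ l, ∑ i ∈ F l, a i) := by
          rw [Finset.mul_sum, ← Finset.sum_add_distrib, ← Finset.sum_add_distrib]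
          refine Finset.sum_le_sum fun l _ => ?_
          rw [hsplit]
          exact (tsirelsonNorm_add_le _ _).trans (add_le_add le_rfl (hF l))
        have hFnn : 0 ≤ ∑ l, ∑ i ∈ F l, a i := Finset.sum_nonneg fun l _ => hpos _
        have hI' := mul_le_mul_of_nonneg_left hIsum (by positivity : (0 : ℝ) ≤ (1 / 2) ^ m)
        -- The outer 1/2 turns `2^{-m}` into `2^{-(m+1)}`; the remaining mass is at most that of `J`
        -- and the sets `F l`, a small set of depth `m + 1`.
        rw [pow_succ]
        linarith
      -- A block met by some `E l` has a support point beyond `n`, and `τ i` bounds its support.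
      · have hnL : ∀ i, (L i).Nonempty → n ≤ τ i + 1 := by
          rintro i ⟨l, hl⟩
          obtain ⟨j, hj, hj'⟩ := (memL i l).1 hl
          have h1 := hn l j hj
          have h2 := hτ i j hj'
          omega
        intro i hi
        rcases Finset.mem_union.1 hi with hi | hi
        · exact hnL i (hJne i hi)
        · obtain ⟨l, -, hl⟩ := Finset.mem_biUnion.1 hi
          exact hnL i ⟨l, ((memI l i).1 (hFI l hl)).2.2⟩

end TsirelsonEstimates

/-! ### Repeated averages that small sets cannot see. -/

section Averages

lemma sum_biUnion_le_sum_sum {ι κ : Type*} [DecidableEq κ] (s : Finset ι) (K : ι → Finset κ)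
    {b : κ → ℝ} (hb : ∀ i, 0 ≤ b i) :
    ∑ i ∈ s.biUnion K, b i ≤ ∑ l ∈ s, ∑ i ∈ K l, b i := by
  classical
  induction s using Finset.induction_on with
  | empty => simp
  | insert l s hl ih =>
    rw [Finset.biUnion_insert, Finset.sum_insert hl]
    refine le_trans ?_ (add_le_add_right ih _)
    rw [← Finset.sum_union_inter]
    exact le_add_of_nonneg_right (Finset.sum_nonneg fun i _ => hb i)

/-- Blocks of averages: a successive union of `r` members of `S_{m+1}` carrying total mass `r`
that is almost invisible to small sets beyond one of its members. -/
lemma exists_successive_averages {c : Ordinal.{0} → ℕ → Ordinal.{0}} {τ : ℕ → ℕ} {m : ℕ}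
    (hm : ∀ ε : ℝ, 0 < ε → ∀ N : ℕ, ∃ F ∈ schreier c ((m + 1 : ℕ) : Ordinal.{0}), ∃ a : ℕ → ℝ,
      (∀ i ∈ F, N ≤ i) ∧ (∀ i, 0 ≤ a i) ∧ (∀ i ∈ F, 0 < a i) ∧ (∀ i ∉ F, a i = 0) ∧
      ∑ i ∈ F, a i = 1 ∧ (∀ i, a i ≤ ε) ∧ ∀ G, IsSmall τ m G → ∑ i ∈ G, a i ≤ ε)
    {η : ℝ} (hη : 0 < η) (N r : ℕ) :
    ∃ (M H : Finset ℕ) (a : ℕ → ℝ), M.card = r ∧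
      IsDecomp (schreier c ((m + 1 : ℕ) : Ordinal.{0})) M H ∧
      (∀ i ∈ H, N ≤ i) ∧ (∀ i, 0 ≤ a i) ∧ (∀ i ∈ H, 0 < a i) ∧ (∀ i ∉ H, a i = 0) ∧
      ∑ i ∈ H, a i = r ∧ (∀ i, a i ≤ 1) ∧
      ∀ G, IsSmall τ (m + 1) G → ∑ i ∈ G, a i ≤ 1 + r * η := by
  classical
  induction r with
  | zero =>
    exact ⟨∅, ∅, fun _ => 0, rfl, IsDecomp.empty _, by simp, by simp, by simp, by simp, by simp,
      by simp, by simp⟩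
  | succ r ih =>
    obtain ⟨M, H, a, hM, hd, hN, ha, hpos, h0, hsum, h1, hG⟩ := ih
    set D := H.sup τ with hD
    have hDpos : (0 : ℝ) < 2 * ((D : ℝ) + 1) := by positivity
    -- A small set meeting `H` has branching number `d ≤ D + 1`. It catches at most `dε` of `b`
    -- through single indices and `dε` through its `d` subsets of lower depth; this `ε` makes the
    -- total at most `η`. The minimum with 1 keeps the coefficients at most 1.
    obtain ⟨F, hF, b, hFN, hb, hbpos, hb0, hbsum, hb1, hbG⟩ :=
      hm (min 1 (η / (2 * ((D : ℝ) + 1)))) (lt_min one_pos (div_pos hη hDpos))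
        (max N (H.sup id + 1))
    have hlt : ∀ i ∈ H, ∀ j ∈ F, i < j := fun i hi j hj => by
      have h2 : i ≤ H.sup id := Finset.le_sup (f := id) hi
      have h3 := (le_max_right _ _).trans (hFN j hj)
      omega
    have hne : F.Nonempty := by
      rw [Finset.nonempty_iff_ne_empty]
      rintro rfl
      simp at hbsum
    have hdisj : Disjoint H F :=
      Finset.disjoint_left.2 fun i hi hi' => lt_irrefl _ (hlt i hi i hi')
    obtain ⟨μ, -, hμM, hdec⟩ := hd.insert hF hne hlt
    refine ⟨insert μ M, H ∪ F, fun i => a i + b i, ?_, hdec, ?_, ?_, ?_, ?_, ?_, ?_, ?_⟩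
    · rw [Finset.card_insert_of_notMem hμM, hM]
    · intro i hi
      rcases Finset.mem_union.1 hi with hi | hi
      · exact hN i hi
      · exact (le_max_left _ _).trans (hFN i hi)
    · exact fun i => add_nonneg (ha i) (hb i)
    · intro i hi
      rcases Finset.mem_union.1 hi with hi | hi
      · exact add_pos_of_pos_of_nonneg (hpos i hi) (hb i)
      · exact add_pos_of_nonneg_of_pos (ha i) (hbpos i hi)
    · intro i hi
      rw [Finset.mem_union, not_or] at hi
      dsimp only
      rw [h0 i hi.1, hb0 i hi.2, add_zero]
    · have e1 : ∑ i ∈ H, b i = 0 :=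
        Finset.sum_eq_zero fun i hi => hb0 i (Finset.disjoint_left.1 hdisj hi)
      have e2 : ∑ i ∈ F, a i = 0 :=
        Finset.sum_eq_zero fun i hi => h0 i (Finset.disjoint_right.1 hdisj hi)
      rw [Finset.sum_union hdisj, Finset.sum_add_distrib, Finset.sum_add_distrib, hsum, hbsum,
        e1, e2]
      push_cast
      ring
    · intro i
      dsimp only
      by_cases hi : i ∈ H
      · rw [hb0 i (Finset.disjoint_left.1 hdisj hi), add_zero]
        exact h1 i
      · rw [h0 i hi, zero_add]
        exact (hb1 i).trans (min_le_left _ _)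
    · intro G hGs
      have hGa := hG G hGs
      rw [Finset.sum_add_distrib]
      -- If `G` meets an earlier block, the new one adds at most `η`; otherwise `G` sees only the
      -- new block, of mass 1.
      by_cases hGH : ∃ i ∈ G, i ∈ H
      · obtain ⟨i₀, hi₀, hi₀H⟩ := hGH
        obtain ⟨d, J, K, hdτ, hJ, hK, hsub⟩ := hGs
        have hdD : (d : ℝ) ≤ D + 1 := by
          have h2 : τ i₀ ≤ D := Finset.le_sup hi₀H
          exact_mod_cast (hdτ i₀ hi₀).trans (Nat.add_le_add_right h2 1)
        set ε := min 1 (η / (2 * ((D : ℝ) + 1))) with hε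
        have hε0 : 0 ≤ ε := (hb 0).trans (hb1 0)
        have e1 : ∑ i ∈ J, b i ≤ d * ε := by
          refine (Finset.sum_le_card_nsmul J b ε fun i _ => hb1 i).trans ?_
          rw [nsmul_eq_mul]
          exact mul_le_mul_of_nonneg_right (by exact_mod_cast hJ) hε0
        have e2 : ∑ i ∈ Finset.univ.biUnion K, b i ≤ d * ε := by
          refine (sum_biUnion_le_sum_sum Finset.univ K hb).trans ?_
          refine (Finset.sum_le_sum fun l _ => hbG _ (hK l)).trans ?_
          simp
        have e3 : ∑ i ∈ G, b i ≤ ∑ i ∈ J, b i + ∑ i ∈ Finset.univ.biUnion K, b i := by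
          refine (Finset.sum_le_sum_of_subset_of_nonneg hsub fun i _ _ => hb i).trans ?_
          rw [← Finset.sum_union_inter]
          exact le_add_of_nonneg_right (Finset.sum_nonneg fun i _ => hb i)
        have e4 : d * ε ≤ η / 2 := by
          refine (mul_le_mul hdD (min_le_right _ _) hε0 (by positivity)).trans (le_of_eq ?_)
          field_simp
        push_cast
        linarith
      · push Not at hGH
        have e1 : ∑ i ∈ G, a i = 0 := Finset.sum_eq_zero fun i hi => h0 i (hGH i hi)
        have e2 : ∑ i ∈ G, b i ≤ 1 := by
          rw [← hbsum, ← Finset.sum_filter_add_sum_filter_not G (· ∈ F)]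
          rw [Finset.sum_eq_zero (s := G.filter fun i => i ∉ F)
            fun i hi => hb0 i (Finset.mem_filter.1 hi).2, add_zero]
          exact Finset.sum_le_sum_of_subset_of_nonneg
            (fun i hi => (Finset.mem_filter.1 hi).2) fun i _ _ => hb i
        rw [e1, zero_add]
        exact e2.trans (le_add_of_nonneg_right (by positivity))

/-- There are averages over sets in `S_{m+1}` that are almost invisible to small sets. -/
lemma exists_average (c : Ordinal.{0} → ℕ → Ordinal.{0}) (τ : ℕ → ℕ) (m : ℕ) (ε : ℝ)
    (hε : 0 < ε) (N : ℕ) :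
    ∃ F ∈ schreier c ((m + 1 : ℕ) : Ordinal.{0}), ∃ a : ℕ → ℝ,
      (∀ i ∈ F, N ≤ i) ∧ (∀ i, 0 ≤ a i) ∧ (∀ i ∈ F, 0 < a i) ∧ (∀ i ∉ F, a i = 0) ∧
      ∑ i ∈ F, a i = 1 ∧ (∀ i, a i ≤ ε) ∧ ∀ G, IsSmall τ m G → ∑ i ∈ G, a i ≤ ε := by
  classical
  induction m generalizing ε N with
  | zero =>
    obtain ⟨k, hk⟩ := exists_nat_ge (1 / ε)
    have hk0 : (0 : ℝ) < k := (by positivity : (0 : ℝ) < 1 / ε).trans_le hk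
    have hkε : 1 / (k : ℝ) ≤ ε := by
      rw [div_le_iff₀ hk0]
      rwa [div_le_iff₀ hε, mul_comm] at hk
    -- A flat average of `k` terms starting beyond `k`; at depth 0 only the empty set is small.
    refine ⟨Finset.Ico (N + k) (N + 2 * k), schreier_one.ge ?_,
      fun i => if i ∈ Finset.Ico (N + k) (N + 2 * k) then 1 / (k : ℝ) else 0,
      ?_, ?_, ?_, ?_, ?_, ?_, ?_⟩
    · intro i hi
      rw [Finset.mem_Ico] at hi
      rw [Nat.card_Ico]
      omega
    · intro i hi
      rw [Finset.mem_Ico] at hi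
      omega
    · intro i
      dsimp only
      split_ifs <;> positivity
    · intro i hi
      dsimp only
      rw [if_pos hi]
      positivity
    · exact fun i hi => if_neg hi
    · rw [Finset.sum_ite_mem, Finset.inter_self, Finset.sum_const, Nat.card_Ico,
        show N + 2 * k - (N + k) = k by omega, nsmul_eq_mul, mul_one_div_cancel hk0.ne']
    · intro i
      dsimp only
      split_ifs
      · exact hkε
      · exact hε.le
    · rintro G rfl
      simpa using hε.le
  | succ m ih =>
    obtain ⟨k, hk⟩ := exists_nat_ge (2 / ε)
    have hk0 : (0 : ℝ) < k := (by positivity : (0 : ℝ) < 2 / ε).trans_le hk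
    have hkε : 2 / (k : ℝ) ≤ ε := by
      rw [div_le_iff₀ hk0]
      rwa [div_le_iff₀ hε, mul_comm] at hk
    -- With `η = 1/k`, a small set catches at most `1 + k · (1/k) = 2`, hence `2/k ≤ ε` after
    -- division by `k`. Starting beyond `k` makes the `k` blocks `S_1`-admissible.
    obtain ⟨M, H, a, hM, hd, hN, ha, hpos, h0, hsum, h1, hG⟩ :=
      exists_successive_averages ih (one_div_pos.2 hk0) (max N k) k
    refine ⟨H, ?_, fun i => a i / k, fun i hi => (le_max_left _ _).trans (hN i hi),
      fun i => div_nonneg (ha i) hk0.le, fun i hi => div_pos (hpos i hi) hk0,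
      fun i hi => by dsimp only; rw [h0 i hi, zero_div], ?_, fun i => ?_, fun G hGs => ?_⟩
    · rw [schreier_succ, mem_famComp_iff]
      refine ⟨M, fun i hi => ?_, hd⟩
      have := (le_max_right _ _).trans (hN i (hd.subset hi))
      omega
    · rw [← Finset.sum_div, hsum, div_self hk0.ne']
    · refine le_trans (div_le_div_of_nonneg_right ((h1 i).trans one_le_two) hk0.le) hkε
    · have h2 := hG G hGs
      rw [mul_one_div_cancel hk0.ne'] at h2
      rw [← Finset.sum_div]
      exact (div_le_div_of_nonneg_right (h2.trans (by norm_num)) hk0.le).trans hkε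

end Averages

/-! ### Upper bounds for the constants, invariant under renorming. -/

section UpperEstimates

/-- `q` is equivalent to the norm of linear combinations of a block sequence in Tsirelson's
space. -/
def IsTsirelsonLike (q : Seminorm ℝ (ℕ →₀ ℝ)) : Prop :=
  ∃ z : ℕ → ℕ →₀ ℝ, Successive (fun i => (z i).support) ∧ ∃ A B : ℝ, 0 < A ∧
    ∀ b, A * tsirelsonNorm (Finsupp.linearCombination ℝ z b) ≤ q b ∧
      q b ≤ B * tsirelsonNorm (Finsupp.linearCombination ℝ z b)

lemma tsirelsonNorm_pos {x : ℕ →₀ ℝ} (hx : x.support.Nonempty) : 0 < tsirelsonNorm x :=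
  lt_of_le_of_ne (tsirelsonNorm_nonneg x) fun h =>
    Finsupp.support_nonempty_iff.1 hx ((tsirelsonNorm_eq_zero x).1 h.symm)

/-- Test the lower estimate on an average of normalized blocks: the sum of the norms is at least
`A`, while the norm of the sum is at most `2B · 2^{-m}`. The family `𝓕` is left free, and `F` may
start arbitrarily far out, so that the same test applies to transfinite classes. -/
lemma IsTsirelsonLike.exists_le {q : Seminorm ℝ (ℕ →₀ ℝ)} (hq : IsTsirelsonLike q)
    (c : Ordinal.{0} → ℕ → Ordinal.{0}) :
    ∃ C : ℝ, ∀ m N : ℕ, ∃ F ∈ schreier c ((m + 1 : ℕ) : Ordinal.{0}), (∀ i ∈ F, N ≤ i) ∧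
      ∀ 𝓕 : Set (Finset ℕ), F ∈ 𝓕 → ∀ d, 0 ≤ d → HasLowerEstimate q 𝓕 d →
        d ≤ C * (1 / 2) ^ m := by
  obtain ⟨z, hz, A, B, hA, hAB⟩ := hq
  have hzpos : ∀ i, 0 < tsirelsonNorm (z i) := fun i => tsirelsonNorm_pos (hz.1 i)
  have hB : 0 ≤ B := by
    have h := hAB (Finsupp.single 0 1)
    rw [Finsupp.linearCombination_single, one_smul] at h
    exact hA.le.trans (le_of_mul_le_mul_right (h.1.trans h.2) (hzpos 0))
  refine ⟨2 * B / A, fun m N => ?_⟩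
  set τ : ℕ → ℕ := fun i => (z i).support.sup id with hτ
  -- The tolerance `2^{-m}` makes the contribution of the small set no larger than the main term.
  obtain ⟨F, hF, a, hFN, ha, hpos, -, hsum, -, hG⟩ :=
    exists_average c τ m ((1 / 2) ^ m) (by positivity) N
  refine ⟨F, hF, hFN, fun 𝓕 hF𝓕 d hd hlow => ?_⟩
  have hsupp : ∀ i ∈ F, (Finsupp.single i (a i / tsirelsonNorm (z i))).support = {i} :=
    fun i hi => Finsupp.support_single _ (div_pos (hpos i hi) (hzpos i)).ne'
  have h1 := hlow F hF𝓕 (fun i => Finsupp.single i (a i / tsirelsonNorm (z i)))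
    ⟨fun i hi => by simp [hsupp i hi], fun i hi j hj => by
        rw [hsupp i hi, Finset.mem_singleton] at hj; exact hj.ge,
      fun i hi i' _ h j hj => by
        rw [hsupp i hi, Finset.mem_singleton] at hj; rwa [hj]⟩
  have h2 : A ≤ ∑ i ∈ F, q (Finsupp.single i (a i / tsirelsonNorm (z i))) := by
    calc A = ∑ i ∈ F, A * a i := by rw [← Finset.mul_sum, hsum, mul_one]
      _ ≤ _ := Finset.sum_le_sum fun i _ => by
        refine le_trans (le_of_eq ?_) (hAB _).1
        rw [Finsupp.linearCombination_single, tsirelsonNorm_smul,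
          abs_of_nonneg (div_nonneg (ha i) (hzpos i).le), div_mul_cancel₀ _ (hzpos i).ne']
  have hlin : Finsupp.linearCombination ℝ z
      (∑ i ∈ F, Finsupp.single i (a i / tsirelsonNorm (z i))) =
        ∑ i ∈ F, a i • ((tsirelsonNorm (z i))⁻¹ • z i) := by
    rw [map_sum]
    exact Finset.sum_congr rfl fun i _ => by
      rw [Finsupp.linearCombination_single, smul_smul, div_eq_mul_inv]
  have hsub : ∀ i, ((tsirelsonNorm (z i))⁻¹ • z i).support ⊆ (z i).support := fun i =>
    Finsupp.support_smul
  obtain ⟨G, -, hGs, h3⟩ := exists_isSmall_tsirelsonNorm_sum_le τ m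
    (y := fun i => (tsirelsonNorm (z i))⁻¹ • z i)
    (fun i i' h j hj j' hj' => hz.2 i i' h j (hsub i hj) j' (hsub i' hj'))
    (fun i => by
      rw [tsirelsonNorm_smul, abs_of_pos (inv_pos.2 (hzpos i)), inv_mul_cancel₀ (hzpos i).ne'])
    (fun i j hj => Finset.le_sup (f := id) (hsub i hj)) ha F
  have h4 := (hAB (∑ i ∈ F, Finsupp.single i (a i / tsirelsonNorm (z i)))).2
  rw [hlin] at h4
  have h5 : tsirelsonNorm (∑ i ∈ F, a i • ((tsirelsonNorm (z i))⁻¹ • z i)) ≤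
      2 * (1 / 2) ^ m := by
    rw [hsum] at h3
    linarith [hG G hGs]
  have h6 : d * A ≤ B * (2 * (1 / 2) ^ m) :=
    ((mul_le_mul_of_nonneg_left h2 hd).trans h1).trans
      (h4.trans (mul_le_mul_of_nonneg_left h5 hB))
  rw [div_mul_eq_mul_div, le_div_iff₀ hA]
  linarith

lemma HasLowerEstimate.le_one {q : Seminorm ℝ (ℕ →₀ ℝ)} (hq : IsTsirelsonLike q)
    {𝓕 : Set (Finset ℕ)} {i : ℕ} (hi : {i} ∈ 𝓕) {d : ℝ} (h : HasLowerEstimate q 𝓕 d) :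
    d ≤ 1 := by
  obtain ⟨z, hz, A, B, hA, hAB⟩ := hq
  have h1 := (hAB (Finsupp.single i 1)).1
  rw [Finsupp.linearCombination_single, one_smul] at h1
  have h2 := (mul_pos hA (tsirelsonNorm_pos (hz.1 i))).trans_le h1
  have h3 := h {i} hi (fun i => Finsupp.single i 1)
    ⟨by simp, by simp, by simp⟩
  rw [Finset.sum_singleton, Finset.sum_singleton] at h3
  exact le_of_mul_le_mul_right (h3.trans_eq (one_mul _).symm) h2

/-- Powers absorb the renorming constant: taking `d` to the power `k + 1` gives `(d · 2^n)^{k+1} ≤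
2C` for every `k`, which is impossible if `d · 2^n > 1`. The factor 2 comes from testing `2^{-m}` on
`S_{m+1}`. -/
lemma HasLowerEstimate.le_pow {q : Seminorm ℝ (ℕ →₀ ℝ)} (hq : IsTsirelsonLike q)
    {c : Ordinal.{0} → ℕ → Ordinal.{0}} {n : ℕ} {d : ℝ} (hd : 0 ≤ d)
    (h : HasLowerEstimate q (schreier c n) d) : d ≤ (1 / 2) ^ n := by
  rcases Nat.eq_zero_or_pos n with rfl | hn
  · simpa using h.le_one hq (singleton_mem_schreier 0 0)
  · obtain ⟨C, hC⟩ := hq.exists_le c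
    by_contra hlt
    have ht : 1 < d * 2 ^ n := by
      rw [not_le, one_div, inv_pow] at hlt
      have := mul_lt_mul_of_pos_right hlt (by positivity : (0 : ℝ) < 2 ^ n)
      rwa [inv_mul_cancel₀ (by positivity)] at this
    obtain ⟨k, hk⟩ := pow_unbounded_of_one_lt (2 * C) ht
    obtain ⟨m, hm⟩ : ∃ m, n * (k + 1) = m + 1 :=
      ⟨n * (k + 1) - 1, (Nat.sub_add_cancel (Nat.mul_pos hn k.succ_pos)).symm⟩
    obtain ⟨F, hF, -, hFd⟩ := hC m 0
    have h1 := hFd _ hF (d ^ (k + 1)) (pow_nonneg hd _) (hm ▸ h.pow hd k)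
    have h2 : (d * 2 ^ n) ^ (k + 1) ≤ 2 * C := by
      rw [mul_pow, ← pow_mul, hm]
      refine (mul_le_mul_of_nonneg_right h1 (by positivity)).trans (le_of_eq ?_)
      rw [pow_succ, mul_assoc, ← mul_assoc ((1 / 2 : ℝ) ^ m), ← mul_pow]
      norm_num
      ring
    exact absurd (hk.le.trans (pow_le_pow_right₀ ht.le k.le_succ)) (by
      intro h3
      have h4 : (d * 2 ^ n) ^ k < (d * 2 ^ n) ^ (k + 1) := pow_lt_pow_right₀ ht k.lt_succ_self
      linarith)

/-- Sufficiently far out, `S_α` contains each `S_{m+1}`, so `d ≤ C · 2^{-m}` for all `m` with one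
constant `C`. -/
lemma HasLowerEstimate.eq_zero {q : Seminorm ℝ (ℕ →₀ ℝ)} (hq : IsTsirelsonLike q)
    {c : Ordinal.{0} → ℕ → Ordinal.{0}} (hc : IsLadder c) {α : Ordinal.{0}}
    (hα : α < Ordinal.omega 1) (hω : Ordinal.omega0 ≤ α) {d : ℝ} (hd : 0 ≤ d)
    (h : HasLowerEstimate q (schreier c α) d) : d = 0 := by
  obtain ⟨C, hC⟩ := hq.exists_le c
  have h1 : ∀ m : ℕ, d ≤ C * (1 / 2) ^ m := by
    intro m
    obtain ⟨N, hN⟩ := exists_mem_schreier_of_le hc (β := ((m + 1 : ℕ) : Ordinal.{0})) α hα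
      ((Ordinal.natCast_lt_omega0 _).le.trans hω)
    obtain ⟨F, hF, hFN, hFd⟩ := hC m N
    exact hFd _ (hN F hF hFN) d hd h
  have h2 : Filter.Tendsto (fun m : ℕ => C * (1 / 2 : ℝ) ^ m) Filter.atTop (nhds (C * 0)) :=
    (tendsto_pow_atTop_nhds_zero_of_lt_one (by norm_num) (by norm_num)).const_mul C
  rw [mul_zero] at h2
  exact le_antisymm (ge_of_tendsto' h2 h1) hd

end UpperEstimates

/-! ### Block bases of block bases. -/

section BlockBasisLemmas

lemma support_linearCombination_subset {z : ℕ → ℕ →₀ ℝ} {b : ℕ →₀ ℝ} {t : ℕ}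
    (ht : t ∈ (Finsupp.linearCombination ℝ z b).support) :
    ∃ j ∈ b.support, t ∈ (z j).support := by
  rw [Finsupp.linearCombination_apply, Finsupp.sum] at ht
  obtain ⟨j, hj, h⟩ := Finset.mem_biUnion.1 (Finsupp.support_finsetSum ht)
  exact ⟨j, hj, Finsupp.support_smul h⟩

lemma Successive.lt_of_linearCombination {z : ℕ → ℕ →₀ ℝ}
    (hz : Successive fun i => (z i).support) {b b' : ℕ →₀ ℝ}
    (hb : ∀ i ∈ b.support, ∀ j ∈ b'.support, i < j) :
    ∀ s ∈ (Finsupp.linearCombination ℝ z b).support,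
      ∀ t ∈ (Finsupp.linearCombination ℝ z b').support, s < t := by
  intro s hs t ht
  obtain ⟨i, hi, hs⟩ := support_linearCombination_subset hs
  obtain ⟨j, hj, ht⟩ := support_linearCombination_subset ht
  exact hz.2 i j (hb i hi j hj) s hs t ht

lemma Successive.linearCombination {z : ℕ → ℕ →₀ ℝ} (hz : Successive fun i => (z i).support)
    {b : ℕ → ℕ →₀ ℝ} (hb : Successive fun i => (b i).support) :
    Successive fun i => (Finsupp.linearCombination ℝ z (b i)).support := by
  refine ⟨fun i => ?_, fun i j hij => hz.lt_of_linearCombination (hb.2 i j hij)⟩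
  obtain ⟨j, hj⟩ := hb.1 i
  obtain ⟨t, ht⟩ := hz.1 j
  refine ⟨t, Finsupp.mem_support_iff.2 ?_⟩
  rw [Finsupp.linearCombination_apply, Finsupp.sum, Finsupp.finsetSum_apply,
    Finset.sum_eq_single j]
  · exact mul_ne_zero (Finsupp.mem_support_iff.1 hj) (Finsupp.mem_support_iff.1 ht)
  · intro j' _ hne
    rw [Finsupp.smul_apply, smul_eq_mul, mul_eq_zero]
    right
    by_contra h0
    have ht' := Finsupp.mem_support_iff.2 h0
    rcases lt_or_gt_of_ne hne with h | h
    · exact lt_irrefl _ (hz.2 j' j h t ht' t ht)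
    · exact lt_irrefl _ (hz.2 j j' h t ht t ht')
  · exact fun h => absurd hj h

variable {V W : Type*} [AddCommGroup V] [Module ℝ V] [AddCommGroup W] [Module ℝ W]

lemma isBlockBasis_shift (x : ℕ → V) (n : ℕ) : IsBlockBasis (fun i => x (n + i)) x := by
  have hs : ∀ i : ℕ, (Finsupp.single i (1 : ℝ)).support = {i} := fun i =>
    Finsupp.support_single _ one_ne_zero
  refine ⟨fun i => Finsupp.single (n + i) 1, ⟨fun i => ?_, fun i j hij a ha b hb => ?_⟩,
    fun i => ?_⟩
  · simp only [hs, Finset.singleton_nonempty]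
  · simp only [hs, Finset.mem_singleton] at ha hb
    omega
  · rw [Finsupp.linearCombination_single, one_smul]

lemma isBlockBasis_self (x : ℕ → V) : IsBlockBasis x x := by
  simpa using isBlockBasis_shift x 0

lemma linearCombination_of_forall_eq {w x : ℕ → V} {a : ℕ → ℕ →₀ ℝ}
    (h : ∀ i, w i = Finsupp.linearCombination ℝ x (a i)) (b : ℕ →₀ ℝ) :
    Finsupp.linearCombination ℝ w b =
      Finsupp.linearCombination ℝ x (Finsupp.linearCombination ℝ a b) := by
  rw [Finsupp.linearCombination_linearCombination]
  simp only [← h]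

lemma IsBlockBasis.trans {y w x : ℕ → V} (hy : IsBlockBasis y w) (hw : IsBlockBasis w x) :
    IsBlockBasis y x := by
  obtain ⟨b, hb, hyb⟩ := hy
  obtain ⟨a, ha, hwa⟩ := hw
  exact ⟨fun i => Finsupp.linearCombination ℝ a (b i), ha.linearCombination hb,
    fun i => by rw [hyb, linearCombination_of_forall_eq hwa]⟩

lemma IsBlockBasis.map {y x : ℕ → V} (hy : IsBlockBasis y x) (f : V →ₗ[ℝ] W) :
    IsBlockBasis (fun i => f (y i)) (fun i => f (x i)) := by
  obtain ⟨b, hb, hyb⟩ := hy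
  exact ⟨b, hb, fun i => by
    dsimp only
    rw [hyb, Finsupp.apply_linearCombination]
    rfl⟩

end BlockBasisLemmas

/-! ### The constants in terms of coefficient seminorms. -/

section DeltaLemmas

variable {V : Type*} [AddCommGroup V] [Module ℝ V]

/-- The seminorm of the linear combinations of a sequence, as a function of the coefficients. -/
noncomputable def coeffSeminorm (p : Seminorm ℝ V) (x : ℕ → V) : Seminorm ℝ (ℕ →₀ ℝ) :=
  p.comp (Finsupp.linearCombination ℝ x)

/-- Transfers the problem to seminorms on coefficient sequences, so that one argument covers the
original norm and all renormings. -/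
lemma delta_eq (p : Seminorm ℝ V) (𝓕 : Set (Finset ℕ)) (x : ℕ → V) :
    delta p 𝓕 x = sSup {d : ℝ | 0 ≤ d ∧ HasLowerEstimate (coeffSeminorm p x) 𝓕 d} := by
  simp only [delta, hasLowerEstimate_iff, coeffSeminorm, Seminorm.comp_apply, map_sum]

lemma delta_nonneg (p : Seminorm ℝ V) (𝓕 : Set (Finset ℕ)) (x : ℕ → V) : 0 ≤ delta p 𝓕 x :=
  Real.sSup_nonneg fun _ h => h.1

variable {p : Seminorm ℝ V} {x : ℕ → V} {c : Ordinal.{0} → ℕ → Ordinal.{0}}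

lemma delta_schreier_le (h : IsTsirelsonLike (coeffSeminorm p x)) (n : ℕ) :
    delta p (schreier c n) x ≤ (1 / 2 : ℝ) ^ n := by
  rw [delta_eq]
  exact Real.sSup_le (fun d hd => hd.2.le_pow h hd.1) (by positivity)

lemma delta_schreier_eq_zero (h : IsTsirelsonLike (coeffSeminorm p x)) (hc : IsLadder c)
    {α : Ordinal.{0}} (hα : α < Ordinal.omega 1) (hω : Ordinal.omega0 ≤ α) :
    delta p (schreier c α) x = 0 := by
  refine le_antisymm ?_ (delta_nonneg _ _ _)
  rw [delta_eq]
  exact Real.sSup_le (fun d hd => (hd.2.eq_zero h hc hα hω hd.1).le) le_rfl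

lemma le_delta_schreier (h : IsTsirelsonLike (coeffSeminorm p x)) {n : ℕ} {d : ℝ} (hd : 0 ≤ d)
    (hlow : HasLowerEstimate (coeffSeminorm p x) (schreier c n) d) :
    d ≤ delta p (schreier c n) x := by
  rw [delta_eq]
  exact le_csSup ⟨1, fun e he => he.2.le_one h (singleton_mem_schreier n 0)⟩ ⟨hd, hlow⟩

/-- Every asymptotic `ℓ₁` constant of a block sequence of Tsirelson's space is at least `2`. -/
lemma two_le_of_mem_asymptoticL1Constants
    (h : IsTsirelsonLike (coeffSeminorm p x)) {C : ℝ} (hC : C ∈ asymptoticL1Constants p x) :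
    2 ≤ C := by
  obtain ⟨hC0, hC⟩ := hC
  -- `S_1` does not depend on the ladder, so a dummy one is used. An `S_1`-admissible family of `k`
  -- blocks starts late enough for the asymptotic `ℓ₁` estimate to apply.
  have hlow : HasLowerEstimate (coeffSeminorm p x) (schreier (fun _ _ => 0) ((1 : ℕ) : Ordinal.{0}))
      (1 / C) := by
    rw [hasLowerEstimate_iff]
    rintro k a ⟨ha, hM⟩
    simp only [coeffSeminorm, Seminorm.comp_apply, map_sum]
    refine hC k a ha fun i j hj => ?_
    rw [schreier_one] at hM
    have h1 := hM _ (mem_minima.2 ⟨i, rfl⟩)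
    rw [minima, Finset.card_image_of_injective _ ha.strictMono_sInf.injective,
      Finset.card_univ, Fintype.card_fin] at h1
    exact h1.trans (Nat.add_le_add_right (sInf_le_of_mem hj) 1)
  have h1 := hlow.le_pow h (one_div_pos.2 hC0).le
  rw [pow_one, div_le_div_iff₀ hC0 two_pos] at h1
  linarith

end DeltaLemmas

/-! ### Block subspaces of Tsirelson's space and their renormings. -/

section TsirelsonBlocks

/-- The embedding of the finitely supported sequences into Tsirelson's space. -/
noncomputable def tsirelsonEmbedding : (ℕ →₀ ℝ) →ₗ[ℝ] TsirelsonSpace where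
  toFun a := ((toTsirelsonC00 a : TsirelsonC00) : TsirelsonSpace)
  map_add' a b := UniformSpace.Completion.coe_add (toTsirelsonC00 a) (toTsirelsonC00 b)
  map_smul' r a := UniformSpace.Completion.coe_smul r (toTsirelsonC00 a)

lemma norm_tsirelsonEmbedding (a : ℕ →₀ ℝ) : ‖tsirelsonEmbedding a‖ = tsirelsonNorm a :=
  UniformSpace.Completion.norm_coe (toTsirelsonC00 a)

lemma linearCombination_tsirelsonBasis :
    Finsupp.linearCombination ℝ tsirelsonBasis = tsirelsonEmbedding := by
  refine Finsupp.lhom_ext' fun i => LinearMap.ext_ring ?_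
  simp only [LinearMap.comp_apply, Finsupp.lsingle_apply, Finsupp.linearCombination_single,
    one_smul]
  rfl

lemma IsBlockBasis.exists_norm_eq {x : ℕ → TsirelsonSpace} (hx : IsBlockBasis x tsirelsonBasis) :
    ∃ z : ℕ → ℕ →₀ ℝ, Successive (fun i => (z i).support) ∧
      ∀ b, ‖Finsupp.linearCombination ℝ x b‖ =
        tsirelsonNorm (Finsupp.linearCombination ℝ z b) := by
  obtain ⟨z, hz, hxz⟩ := hx
  refine ⟨z, hz, fun b => ?_⟩
  rw [linearCombination_of_forall_eq hxz, linearCombination_tsirelsonBasis,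
    norm_tsirelsonEmbedding]

lemma linearCombination_coe {x : ℕ → TsirelsonSpace} (y : ℕ → closedSpan x) (b : ℕ →₀ ℝ) :
    ((Finsupp.linearCombination ℝ y b : closedSpan x) : TsirelsonSpace) =
      Finsupp.linearCombination ℝ (fun i => (y i : TsirelsonSpace)) b :=
  Finsupp.apply_linearCombination ℝ (closedSpan x).subtype y b

variable {x : ℕ → TsirelsonSpace}

lemma IsBlockBasis.isTsirelsonLike_norm (hx : IsBlockBasis x tsirelsonBasis) :
    IsTsirelsonLike (coeffSeminorm (normSeminorm ℝ TsirelsonSpace) x) := by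
  obtain ⟨z, hz, h⟩ := hx.exists_norm_eq
  refine ⟨z, hz, 1, 1, one_pos, fun b => ?_⟩
  have : coeffSeminorm (normSeminorm ℝ TsirelsonSpace) x b =
      tsirelsonNorm (Finsupp.linearCombination ℝ z b) := h b
  rw [this, one_mul]
  exact ⟨le_rfl, le_rfl⟩

/-- A block basis of `x` is again a block basis of the unit vectors, and the equivalence constants
of `p` restrict to its linear combinations. -/
lemma IsBlockBasis.isTsirelsonLike (hx : IsBlockBasis x tsirelsonBasis)
    {p : Seminorm ℝ (closedSpan x)} (hp : IsEquivalentNorm p) {y : ℕ → closedSpan x}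
    (hy : IsBlockBasis y (inSpan x)) : IsTsirelsonLike (coeffSeminorm p y) := by
  have hy' : IsBlockBasis (fun i => (y i : TsirelsonSpace)) x :=
    hy.map (closedSpan x).subtype
  obtain ⟨z, hz, h⟩ := (hy'.trans hx).exists_norm_eq
  obtain ⟨A, B, hA, hAB⟩ := hp
  refine ⟨z, hz, A, B, hA, fun b => ?_⟩
  rw [← h, ← linearCombination_coe]
  exact hAB _

lemma coeffSeminorm_inSpan (x : ℕ → TsirelsonSpace) :
    coeffSeminorm (normSeminorm ℝ (closedSpan x)) (inSpan x) =
      coeffSeminorm (normSeminorm ℝ TsirelsonSpace) x := by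
  ext b
  exact congrArg norm (linearCombination_coe (inSpan x) b)

/-- The `i`-th block is supported from `i` on, so families admissible with respect to `x` remain far
enough out with respect to the unit vectors. -/
lemma IsBlockBasis.hasLowerEstimate (hx : IsBlockBasis x tsirelsonBasis)
    (c : Ordinal.{0} → ℕ → Ordinal.{0}) (n : ℕ) :
    HasLowerEstimate (coeffSeminorm (normSeminorm ℝ TsirelsonSpace) x) (schreier c n)
      ((1 / 2) ^ n) := by
  obtain ⟨z, hz, h⟩ := hx.exists_norm_eq
  have hq : ∀ b, coeffSeminorm (normSeminorm ℝ TsirelsonSpace) x b =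
      tsirelsonNorm (Finsupp.linearCombination ℝ z b) := h
  intro M hM u hu
  simp only [hq, map_sum]
  refine pow_mul_sum_tsirelsonNorm_le n hM ?_ ?_
  · intro μ hμ ν hν hlt
    exact hz.lt_of_linearCombination fun i hi j hj =>
      (hu.lt μ hμ ν hν hlt i hi).trans_le (hu.le ν hν j hj)
  · intro μ hμ t ht
    obtain ⟨j, hj, ht⟩ := support_linearCombination_subset ht
    exact (hu.le μ hμ j hj).trans (hz.le_of_mem j t ht)

variable (c : Ordinal.{0} → ℕ → Ordinal.{0})

lemma IsBlockBasis.delta_eq_pow (hx : IsBlockBasis x tsirelsonBasis) (n : ℕ) :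
    delta (normSeminorm ℝ TsirelsonSpace) (schreier c n) x = (1 / 2 : ℝ) ^ n :=
  le_antisymm (delta_schreier_le hx.isTsirelsonLike_norm n)
    (le_delta_schreier hx.isTsirelsonLike_norm (by positivity) (hx.hasLowerEstimate c n))

lemma IsBlockBasis.ddotDelta_eq_pow (hx : IsBlockBasis x tsirelsonBasis) (n : ℕ) :
    ddotDelta (schreier c n) x = (1 / 2 : ℝ) ^ n := by
  have hpos : (0 : ℝ) ≤ (1 / 2) ^ n := by positivity
  have h1 : ∀ p : Seminorm ℝ (closedSpan x), IsEquivalentNorm p →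
      ∀ d ∈ {d : ℝ | ∃ y : ℕ → closedSpan x, IsBlockBasis y (inSpan x) ∧
        d = delta p (schreier c n) y}, d ≤ (1 / 2 : ℝ) ^ n := by
    rintro p hp _ ⟨y, hy, rfl⟩
    exact delta_schreier_le (hx.isTsirelsonLike hp hy) n
  have h2 : ∀ d ∈ {d : ℝ | ∃ p : Seminorm ℝ (closedSpan x), IsEquivalentNorm p ∧
      d = dotDelta p (schreier c n) (inSpan x)}, d ≤ (1 / 2 : ℝ) ^ n := by
    rintro _ ⟨p, hp, rfl⟩
    exact Real.sSup_le (h1 p hp) hpos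
  refine le_antisymm (Real.sSup_le h2 hpos) ?_
  have hnorm : IsEquivalentNorm (normSeminorm ℝ (closedSpan x)) :=
    ⟨1, 1, one_pos, fun v => by simp⟩
  -- The supremum is attained by the original norm and by `x` itself.
  refine le_trans ?_ (le_csSup ⟨_, h2⟩ ⟨_, hnorm, rfl⟩)
  refine le_csSup_of_le ⟨_, h1 _ hnorm⟩ ⟨inSpan x, isBlockBasis_self _, rfl⟩ ?_
  rw [delta_eq, coeffSeminorm_inSpan, ← delta_eq, hx.delta_eq_pow]

lemma IsBlockBasis.two_mem_asymptoticL1Constants (hx : IsBlockBasis x tsirelsonBasis) :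
    (2 : ℝ) ∈ asymptoticL1Constants (normSeminorm ℝ TsirelsonSpace) x := by
  refine ⟨two_pos, fun n a ha hn => ?_⟩
  have h := hx.hasLowerEstimate (fun _ _ => 0) 1
  rw [hasLowerEstimate_iff] at h
  have h1 := h n a ⟨ha, schreier_one.ge fun i hi => ?_⟩
  · simpa only [coeffSeminorm, Seminorm.comp_apply, map_sum, pow_one] using h1
  · obtain ⟨l, rfl⟩ := mem_minima.1 hi
    refine le_trans ?_ (hn l _ (sInf_mem_of_nonempty (ha.1 l)))
    exact Finset.card_image_le.trans (by simp)

end TsirelsonBlocks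

/-! ### Stabilized values and the theorem. -/

section Spectra

variable {V : Type*} [AddCommGroup V] [Module ℝ V] {p : Seminorm ℝ V} {x : ℕ → V}
  {c : Ordinal.{0} → ℕ → Ordinal.{0}} {γ : Set.Iio (Ordinal.omega.{0} 1) → ℝ}

/-- A stabilized value lies in every closed set that contains all `δ_α(y)`. -/
lemma DeltaStabilizes.mem_of_isClosed (h : DeltaStabilizes c p x γ)
    (α : Set.Iio (Ordinal.omega.{0} 1)) {S : Set ℝ} (hS : IsClosed S)
    (hy : ∀ y : ℕ → V, IsBlockBasis y x → delta p (schreier c α) y ∈ S) : γ α ∈ S := by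
  obtain ⟨ε, -, hε, h⟩ := h
  obtain ⟨m, hm⟩ := h α
  -- The constants of the tails of `x`, which are themselves block bases, converge to the stabilized
  -- value.
  have h1 : Filter.Tendsto (fun n => delta p (schreier c α) fun i => x (n + i)) Filter.atTop
      (nhds (γ α)) := by
    rw [tendsto_iff_dist_tendsto_zero]
    refine squeeze_zero' (Filter.Eventually.of_forall fun _ => dist_nonneg) ?_ hε
    filter_upwards [Filter.eventually_ge_atTop m] with n hn
    exact (hm n hn _ (isBlockBasis_self _)).le
  exact hS.mem_of_tendsto h1 (Filter.Eventually.of_forall fun n => hy _ (isBlockBasis_shift x n))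

end Spectra

theorem theorem5p2 (c : Ordinal.{0} → ℕ → Ordinal.{0}) (hc : IsLadder c) :
    -- block bases of the unit vector basis, in the original norm and up to renorming
    (∀ x : ℕ → TsirelsonSpace, IsBlockBasis x tsirelsonBasis → ∀ n : ℕ,
      delta (normSeminorm ℝ TsirelsonSpace) (schreier c n) x = (1 / 2 : ℝ) ^ n ∧
      ddotDelta (schreier c n) x = (1 / 2 : ℝ) ^ n) ∧
    -- the spectrum
    (∀ γ ∈ deltaSpectrum c tsirelsonBasis,
      (∀ n : ℕ, γ (finiteIndex n) = (1 / 2 : ℝ) ^ n) ∧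
      ∀ α : Set.Iio (Ordinal.omega.{0} 1), Ordinal.omega0 ≤ (α : Ordinal.{0}) → γ α = 0) ∧
    -- the spectrum up to renorming
    (∀ γ ∈ ddotDeltaSpectrum c tsirelsonBasis, ∀ n : ℕ,
      γ (finiteIndex n) ≤ (1 / 2 : ℝ) ^ n) ∧
    -- the spectral index of every block subspace
    (∀ x : ℕ → TsirelsonSpace, IsBlockBasis x tsirelsonBasis → spectralIndex c x = 1) ∧
    -- the asymptotic `ℓ₁` constant of a block subspace is 2 and no renorming improves it
    (∀ x : ℕ → TsirelsonSpace, IsBlockBasis x tsirelsonBasis →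
      IsGLB (asymptoticL1Constants (normSeminorm ℝ TsirelsonSpace) x) 2 ∧
      ∀ p : Seminorm ℝ (closedSpan x), IsEquivalentNorm p →
        ∀ C ∈ asymptoticL1Constants p (inSpan x), 2 ≤ C) := by
  refine ⟨fun x hx n => ⟨hx.delta_eq_pow c n, hx.ddotDelta_eq_pow c n⟩, ?_, ?_, ?_, ?_⟩
  · rintro γ ⟨x, hx, h⟩
    refine ⟨fun n => ?_, fun α hα => ?_⟩
    · exact h.mem_of_isClosed (finiteIndex n) (isClosed_singleton (x := (1 / 2 : ℝ) ^ n))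
        fun y hy => (hy.trans hx).delta_eq_pow c n
    · exact h.mem_of_isClosed α (isClosed_singleton (x := (0 : ℝ))) fun y hy =>
        delta_schreier_eq_zero (hy.trans hx).isTsirelsonLike_norm hc α.2 hα
  · rintro γ ⟨x, hx, p, hp, h⟩ n
    exact h.mem_of_isClosed (finiteIndex n) (isClosed_Iic (a := (1 / 2 : ℝ) ^ n)) fun y hy =>
      delta_schreier_le (hx.isTsirelsonLike hp hy) n
  · intro x hx
    have h0 := hx.ddotDelta_eq_pow c 0
    have h1 := hx.ddotDelta_eq_pow c 1
    rw [Nat.cast_zero, pow_zero] at h0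
    rw [Nat.cast_one, pow_one] at h1
    have hmem : (1 : Ordinal.{0}) ∈
        {α : Ordinal.{0} | α < Ordinal.omega 1 ∧ ddotDelta (schreier c α) x < 1} :=
      ⟨Ordinal.one_lt_omega0.trans Ordinal.omega0_lt_omega_one, by rw [h1]; norm_num⟩
    -- The index is at most 1 since `δ̈_1 = 1/2`, and it is not 0 since `δ̈_0 = 1`.
    refine le_antisymm (csInf_le' hmem) (Order.one_le_iff_ne_zero.2 fun h => ?_)
    have h2 := csInf_mem (s := {α : Ordinal.{0} | α < Ordinal.omega 1 ∧
      ddotDelta (schreier c α) x < 1}) ⟨1, hmem⟩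
    have h3 : sInf {α : Ordinal.{0} | α < Ordinal.omega 1 ∧
      ddotDelta (schreier c α) x < 1} = 0 := h
    rw [h3] at h2
    exact absurd h2.2 (by rw [h0]; exact lt_irrefl _)
  · intro x hx
    refine ⟨⟨fun C hC => two_le_of_mem_asymptoticL1Constants hx.isTsirelsonLike_norm hC,
      fun b hb => hb hx.two_mem_asymptoticL1Constants⟩, fun p hp C hC => ?_⟩
    exact two_le_of_mem_asymptoticL1Constants
      (hx.isTsirelsonLike hp (isBlockBasis_self _)) hC
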